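/- Let $d\ge 1$. A function $V$ on $\mathbb{R}$ with values in the complex $d\times d$ matrices is a matrix weight if its entries are locally integrable and $V(x)$ is positive definite for almost every $x$. For a bounded nondegenerate interval $I$ write $\langle V\rangle_I=\frac1{|I|}\int_I V(y)\,dy$. A matrix weight $V$ is a matrix $A_2$ weight if $V^{-1}$ also has locally integrable entries and $$[V]_{A_2}=\sup_I\big\|\langle V\rangle_I^{1/2}\langle V^{-1}\rangle_I^{1/2}\big\|^2<\infty ,$$ where the supremum is over all bounded nondegenerate intervals $I\subset\mathbb{R}$ and $\|\cdot\|$ is the operator norm on $\mathbb{C}^d$ with its Euclidean norm. For $f\in L^2(\mathbb{R},\mathbb{C}^d)$ define $$\widetilde M_Vf(x)=\sup_{I\ni x}\frac1{|I|}\int_I\big\|\langle V\rangle_I^{1/2}V^{-1/2}(y)f(y)\big\|\,dy ,$$ where the supremum is over all bounded nondegenerate intervals $I$ containing $x$. Then there is a constant $C_d<\infty$, depending only on $d$, such that for every $d\times d$ matrix $A_2$ weight $V$ and every $f\in L^2(\mathbb{R},\mathbb{C}^d)$, the function $\widetilde M_Vf$ belongs to $L^2(\mathbb{R})$ and $$\|\widetilde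 M_Vf\|_{L^2(\mathbb{R})}\le C_d\,[V]_{A_2}\,\|f\|_{L^2(\mathbb{R},\mathbb{C}^d)} .$$ -/

import Mathlib

open MeasureTheory
open scoped ENNReal NNReal MatrixOrder ComplexOrder

noncomputable section

/-- Square matrix functions on the line are taken with entries in `ℂ`. A matrix weight: the entries
are locally integrable and the values are positive definite almost everywhere. -/
structure IsMatrixWeight {d : ℕ} (V : ℝ → Matrix (Fin d) (Fin d) ℂ) : Prop where
  locallyIntegrable : ∀ i j, LocallyIntegrable (fun x => V x i j) volume
  posDef : ∀ᵐ x ∂(volume : Measure ℝ), (V x).PosDef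

/-- The entrywise average of a matrix function over the interval with endpoints `a < b`. (Whether
an endpoint belongs to the interval does not affect the average.) -/
def matrixAvg {d : ℕ} (V : ℝ → Matrix (Fin d) (Fin d) ℂ) (a b : ℝ) :
    Matrix (Fin d) (Fin d) ℂ :=
  Matrix.of fun i j => ⨍ x in Set.Icc a b, V x i j

/-- The `A₂` characteristic: the supremum, over all bounded nondegenerate intervals `I`, of the
squared operator norm on Euclidean `ℂ^d` of `⟨V⟩_I ^ (1/2) * ⟨V⁻¹⟩_I ^ (1/2)`. It is used only for
functions `V` such that both `V` and `V⁻¹` have locally integrable entries. -/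
def matrixA2Char {d : ℕ} (V : ℝ → Matrix (Fin d) (Fin d) ℂ) : ℝ≥0∞ :=
  ⨆ (a : ℝ) (b : ℝ) (_ : a < b),
    ‖Matrix.toEuclideanCLM (𝕜 := ℂ)
      (CFC.sqrt (matrixAvg V a b) * CFC.sqrt (matrixAvg (fun x => (V x)⁻¹) a b))‖ₑ ^ 2

/-- A matrix `A₂` weight: a matrix weight whose `A₂` characteristic is finite; in particular
the averages of `V⁻¹` that occur in the characteristic have to be finite. -/
structure IsMatrixA2 {d : ℕ} (V : ℝ → Matrix (Fin d) (Fin d) ℂ) : Prop where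
  weight : IsMatrixWeight V
  inv_locallyIntegrable : ∀ i j, LocallyIntegrable (fun x => (V x)⁻¹ i j) volume
  char_lt_top : matrixA2Char V < ∞

/-- The Christ-Goldberg maximal function: the supremum, over all bounded nondegenerate intervals `I`
containing `x`, of the average over `I` of `‖⟨V⟩_I ^ (1/2) V(y) ^ (-1/2) f(y)‖`. An interval that
contains `x` may be replaced by its closure, so closed intervals suffice. -/
def christGoldbergMaximal {d : ℕ} (V : ℝ → Matrix (Fin d) (Fin d) ℂ)
    (f : ℝ → EuclideanSpace ℂ (Fin d)) (x : ℝ) : ℝ≥0∞ :=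
  ⨆ (a : ℝ) (b : ℝ) (_ : a < b) (_ : x ∈ Set.Icc a b),
    ⨍⁻ y in Set.Icc a b,
      ‖Matrix.toEuclideanCLM (𝕜 := ℂ)
        (CFC.sqrt (matrixAvg V a b) * (CFC.sqrt (V y))⁻¹) (f y)‖ₑ ∂volume

end

/-! Write `Q` for the characteristic of `V`. For a fixed vector `v`, the scalar weight `σ = ⟨V⁻¹v,
v⟩` inherits a quantitative A∞ property. With `g = ⟨V⁻¹⟩_I v`, integrating the square root of `|⟨g,
v⟩|² ≤ ⟨Vg, g⟩⟨V⁻¹v, v⟩` over `E ⊆ I` and using the A₂ bound gives `(|E|/|I|)² σ(I) ≤ Q σ(E)`.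
Applied to complements, this shows that a subset filling at most half of `I` carries at most the
fraction `1 - 1/(4Q)` of `σ(I)` (`lintegral_quadForm_inv_le_of_volume_le`). A stopping-time argument
converts this into a reverse Hölder inequality with exponent `1 + ε`, `ε = 1/(16Q)`, uniformly in
`v` and `I` (`lintegral_rpow_one_add_le`).

For `B = ⟨V⟩_I^(1/2)` and `v = B eᵢ` the average of `σ` is at most `Q`. Hölder's inequality then
dominates the Christ-Goldberg function pointwise by `2 d Q^(1/2) M(|f|^p)^(1/p)`, where `M` is the
Hardy–Littlewood maximal function and `p < 2` is conjugate to `2(1 + ε)`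
(`christGoldbergMaximal_le`). With `r = 2/p`, the `r`-th power integral bound for `M` costs `O(1/(r
- 1)) = O(Q)` (`lintegral_maximalFunction_rpow_le`). After squaring, the factors `Q` and `O(Q)`
multiply to `O(Q²)`, which is linear dependence in the norm. -/

open Set Filter Topology
open scoped InnerProductSpace Matrix
open Matrix (toEuclideanCLM)

/-! ### Dyadic stopping sets and the reverse Hölder inequality -/

/-- The union of the maximal intervals, among the dyadic descendants of `(a, b]` down to
generation `n`, on which the average of `w` exceeds `t`. -/
noncomputable def stoppingSet (w : ℝ → ℝ≥0∞) (t : ℝ≥0∞) : ℕ → ℝ → ℝ → Set ℝ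
  | 0, a, b => if t * ENNReal.ofReal (b - a) < ∫⁻ y in Ioc a b, w y then Ioc a b else ∅
  | n + 1, a, b => if t * ENNReal.ofReal (b - a) < ∫⁻ y in Ioc a b, w y then Ioc a b else
      stoppingSet w t n a ((a + b) / 2) ∪ stoppingSet w t n ((a + b) / 2) b

section StoppingSet

variable {w : ℝ → ℝ≥0∞} {t : ℝ≥0∞} {a b : ℝ}

lemma stoppingSet_of_lt (n : ℕ) (h : t * ENNReal.ofReal (b - a) < ∫⁻ y in Ioc a b, w y) :
    stoppingSet w t n a b = Ioc a b := by
  cases n <;> simp [stoppingSet, h]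

lemma stoppingSet_zero_of_le (h : ∫⁻ y in Ioc a b, w y ≤ t * ENNReal.ofReal (b - a)) :
    stoppingSet w t 0 a b = ∅ := by
  simp [stoppingSet, not_lt.2 h]

lemma stoppingSet_succ_of_le (n : ℕ)
    (h : ∫⁻ y in Ioc a b, w y ≤ t * ENNReal.ofReal (b - a)) :
    stoppingSet w t (n + 1) a b =
      stoppingSet w t n a ((a + b) / 2) ∪ stoppingSet w t n ((a + b) / 2) b := by
  simp [stoppingSet, not_lt.2 h]

lemma measurableSet_stoppingSet (n : ℕ) : MeasurableSet (stoppingSet w t n a b) := by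
  induction n generalizing a b with
  | zero => unfold stoppingSet; split_ifs <;> simp
  | succ n ih => unfold stoppingSet; split_ifs; exacts [measurableSet_Ioc, ih.union ih]

lemma stoppingSet_subset (n : ℕ) (hab : a ≤ b) : stoppingSet w t n a b ⊆ Ioc a b := by
  induction n generalizing a b with
  | zero => unfold stoppingSet; split_ifs <;> simp
  | succ n ih =>
    unfold stoppingSet
    split_ifs
    · exact subset_rfl
    · refine union_subset ((ih (by linarith)).trans (Ioc_subset_Ioc_right (by linarith)))
        ((ih (by linarith)).trans (Ioc_subset_Ioc_left (by linarith)))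

lemma stoppingSet_subset_succ (n : ℕ) : stoppingSet w t n a b ⊆ stoppingSet w t (n + 1) a b := by
  induction n generalizing a b with
  | zero =>
    rcases lt_or_ge (t * ENNReal.ofReal (b - a)) (∫⁻ y in Ioc a b, w y) with h | h
    · rw [stoppingSet_of_lt _ h, stoppingSet_of_lt _ h]
    · simp [stoppingSet_zero_of_le h]
  | succ n ih =>
    rcases lt_or_ge (t * ENNReal.ofReal (b - a)) (∫⁻ y in Ioc a b, w y) with h | h
    · rw [stoppingSet_of_lt _ h, stoppingSet_of_lt _ h]
    · rw [stoppingSet_succ_of_le _ h, stoppingSet_succ_of_le _ h]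
      exact union_subset_union ih ih

lemma disjoint_stoppingSet_halves (s t : ℝ≥0∞) (m n : ℕ) (hab : a ≤ b) :
    Disjoint (stoppingSet w s m a ((a + b) / 2)) (stoppingSet w t n ((a + b) / 2) b) :=
  Disjoint.mono (stoppingSet_subset m (by linarith)) (stoppingSet_subset n (by linarith))
    (Ioc_disjoint_Ioc_of_le le_rfl)

lemma mul_volume_stoppingSet_le (n : ℕ) (hab : a ≤ b) :
    t * volume (stoppingSet w t n a b) ≤ ∫⁻ y in stoppingSet w t n a b, w y := by
  induction n generalizing a b with
  | zero =>
    rcases lt_or_ge (t * ENNReal.ofReal (b - a)) (∫⁻ y in Ioc a b, w y) with h | h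
    · rw [stoppingSet_of_lt _ h, Real.volume_Ioc]; exact h.le
    · simp [stoppingSet_zero_of_le h]
  | succ n ih =>
    rcases lt_or_ge (t * ENNReal.ofReal (b - a)) (∫⁻ y in Ioc a b, w y) with h | h
    · rw [stoppingSet_of_lt _ h, Real.volume_Ioc]; exact h.le
    · rw [stoppingSet_succ_of_le _ h,
        lintegral_union (measurableSet_stoppingSet n) (disjoint_stoppingSet_halves t t n n hab),
        measure_union (disjoint_stoppingSet_halves t t n n hab) (measurableSet_stoppingSet n),
        mul_add]
      exact add_le_add (ih (by linarith)) (ih (by linarith))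

/-- Descending into the half that contains `x` never meets a stopping interval, so the recursion
reaches generation `n`. -/
lemma exists_Ioc_of_notMem_stoppingSet (n : ℕ) {x : ℝ} (hx : x ∈ Ioc a b)
    (h : x ∉ stoppingSet w t n a b) :
    ∃ c d, x ∈ Ioc c d ∧ Ioc c d ⊆ Ioc a b ∧ d - c = (b - a) / 2 ^ n ∧
      ∫⁻ y in Ioc c d, w y ≤ t * ENNReal.ofReal (d - c) := by
  induction n generalizing a b with
  | zero =>
    rcases lt_or_ge (t * ENNReal.ofReal (b - a)) (∫⁻ y in Ioc a b, w y) with h' | h'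
    · rw [stoppingSet_of_lt _ h'] at h; exact absurd hx h
    · exact ⟨a, b, hx, subset_rfl, by simp, h'⟩
  | succ n ih =>
    rcases lt_or_ge (t * ENNReal.ofReal (b - a)) (∫⁻ y in Ioc a b, w y) with h' | h'
    · rw [stoppingSet_of_lt _ h'] at h; exact absurd hx h
    · rw [stoppingSet_succ_of_le _ h', mem_union, not_or] at h
      rcases le_or_gt x ((a + b) / 2) with hm | hm
      · obtain ⟨c, d, h1, h2, h3, h4⟩ := ih ⟨hx.1, hm⟩ h.1
        refine ⟨c, d, h1, h2.trans (Ioc_subset_Ioc_right (by linarith [hx.1, hx.2])), ?_, h4⟩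
        rw [h3, pow_succ]; field_simp; ring
      · obtain ⟨c, d, h1, h2, h3, h4⟩ := ih ⟨hm, hx.2⟩ h.2
        refine ⟨c, d, h1, h2.trans (Ioc_subset_Ioc_left (by linarith [hx.1, hx.2])), ?_, h4⟩
        rw [h3, pow_succ]; field_simp; ring

/-- A maximal interval `J` at level `t` has average at most `2t`, because its parent was not
selected; the hypothesis `h` carries this bound down the recursion. Inside `J` the set `S` selected
at level `4t` satisfies `4t|S| ≤ w(S) ≤ w(J) ≤ 2t|J|`, so it fills at most half of `J` and `hw`
applies. -/
lemma lintegral_stoppingSet_four_mul_le {η : ℝ≥0∞}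
    (hw : ∀ a b : ℝ, a < b → ∀ E ⊆ Ioc a b, MeasurableSet E →
      2 * volume E ≤ ENNReal.ofReal (b - a) → ∫⁻ y in E, w y ≤ η * ∫⁻ y in Ioc a b, w y)
    (ht : t ≠ 0) (ht' : t ≠ ∞) (n : ℕ) (hab : a < b)
    (h : ∫⁻ y in Ioc a b, w y ≤ 2 * t * ENNReal.ofReal (b - a)) :
    ∫⁻ y in stoppingSet w (4 * t) n a b, w y ≤ η * ∫⁻ y in stoppingSet w t n a b, w y := by
  have h24 : 2 * t ≤ 4 * t := by gcongr; norm_num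
  have top_case : ∀ (n : ℕ) {a b : ℝ}, a < b →
      ∫⁻ y in Ioc a b, w y ≤ 2 * t * ENNReal.ofReal (b - a) →
      t * ENNReal.ofReal (b - a) < ∫⁻ y in Ioc a b, w y →
      ∫⁻ y in stoppingSet w (4 * t) n a b, w y ≤ η * ∫⁻ y in stoppingSet w t n a b, w y := by
    intro n a b hab h h'
    rw [stoppingSet_of_lt (t := t) n h']
    refine hw a b hab _ (stoppingSet_subset n hab.le) (measurableSet_stoppingSet n) ?_
    have h1 := (mul_volume_stoppingSet_le (w := w) (t := 4 * t) n hab.le).trans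
      ((lintegral_mono_set (stoppingSet_subset n hab.le)).trans h)
    have h2 : (2 * t) * (2 * volume (stoppingSet w (4 * t) n a b)) ≤
        (2 * t) * ENNReal.ofReal (b - a) := by
      refine le_trans (le_of_eq ?_) h1
      rw [← mul_assoc]; congr 1; ring
    exact (ENNReal.mul_le_mul_iff_right (by simp [ht]) (ENNReal.mul_ne_top (by simp) ht')).1 h2
  induction n generalizing a b with
  | zero =>
    rcases lt_or_ge (t * ENNReal.ofReal (b - a)) (∫⁻ y in Ioc a b, w y) with h' | h'
    · exact top_case 0 hab h h'
    · rw [stoppingSet_zero_of_le (h.trans (by gcongr))]; simp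
  | succ n ih =>
    rcases lt_or_ge (t * ENNReal.ofReal (b - a)) (∫⁻ y in Ioc a b, w y) with h' | h'
    · exact top_case _ hab h h'
    · have hl : ENNReal.ofReal (b - a) = 2 * ENNReal.ofReal ((b - a) / 2) := by
        rw [← ENNReal.ofReal_ofNat, ← ENNReal.ofReal_mul (by norm_num)]; congr 1; ring
      rw [stoppingSet_succ_of_le _ h', stoppingSet_succ_of_le _ (h.trans (by gcongr)),
        lintegral_union (measurableSet_stoppingSet n) (disjoint_stoppingSet_halves _ _ n n hab.le),
        lintegral_union (measurableSet_stoppingSet n) (disjoint_stoppingSet_halves _ _ n n hab.le),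
        mul_add]
      rw [hl] at h'
      refine add_le_add (ih (by linarith) ?_) (ih (by linarith) ?_)
      · refine (lintegral_mono_set (Ioc_subset_Ioc_right (by linarith))).trans
          (h'.trans (le_of_eq ?_))
        rw [show (a + b) / 2 - a = (b - a) / 2 by ring]; ring
      · refine (lintegral_mono_set (Ioc_subset_Ioc_left (by linarith))).trans
          (h'.trans (le_of_eq ?_))
        rw [show b - (a + b) / 2 = (b - a) / 2 by ring]; ring

/-- Lebesgue differentiation along the unselected dyadic intervals shrinking to `x`. The exceptional
null set does not depend on `t`. -/
lemma ae_le_of_forall_notMem_stoppingSet (hwm : AEMeasurable w volume)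
    (hfin : ∫⁻ y in Ioc a b, w y ≠ ∞) :
    ∀ᵐ x ∂(volume : Measure ℝ), ∀ t, x ∈ Ioc a b → (∀ n, x ∉ stoppingSet w t n a b) → w x ≤ t := by
  have hm : AEMeasurable ((Ioc a b).indicator w) volume := hwm.indicator measurableSet_Ioc
  have hf : ∫⁻ y, (Ioc a b).indicator w y ≠ ∞ := by
    rwa [lintegral_indicator measurableSet_Ioc]
  -- The parameter `1` admits balls that contain `x` without being centred at it, as dyadic
  -- intervals are.
  filter_upwards [(IsUnifLocDoublingMeasure.vitaliFamily (volume : Measure ℝ)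
    1).ae_tendsto_lintegral_div hm hf] with x hx t hxI hxt
  choose c d h1 h2 h3 h4 using fun n => exists_Ioc_of_notMem_stoppingSet n hxI (hxt n)
  have hab : 0 < b - a := by linarith [hxI.1, hxI.2]
  have hlen : ∀ n, 0 < d n - c n := fun n => by rw [h3]; positivity
  have hδ : Tendsto (fun n => (d n - c n) / 2) atTop (𝓝[>] 0) := by
    refine tendsto_nhdsWithin_iff.2 ⟨?_, Eventually.of_forall fun n => half_pos (hlen n)⟩
    have : Tendsto (fun n : ℕ => (b - a) / 2 * (1 / 2 : ℝ) ^ n) atTop (𝓝 ((b - a) / 2 * 0)) :=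
      (tendsto_pow_atTop_nhds_zero_of_lt_one (by norm_num) (by norm_num)).const_mul _
    rw [mul_zero] at this
    refine this.congr fun n => ?_
    rw [h3]; simp; ring
  have hball : ∀ n, Metric.closedBall ((c n + d n) / 2) ((d n - c n) / 2) = Icc (c n) (d n) :=
    fun n => by rw [Real.closedBall_eq_Icc]; congr 1 <;> ring
  have hmem : ∀ᶠ n in atTop, x ∈ Metric.closedBall ((c n + d n) / 2) (1 * ((d n - c n) / 2)) :=
    Eventually.of_forall fun n => by rw [one_mul, hball]; exact Ioc_subset_Icc_self (h1 n)
  have hlim := hx.comp (IsUnifLocDoublingMeasure.tendsto_closedBall_filterAt volume _ _ hδ hmem)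
  rw [indicator_of_mem hxI] at hlim
  refine le_of_tendsto hlim (Eventually.of_forall fun n => ?_)
  simp only [Function.comp_apply, hball]
  rw [setLIntegral_congr Ioc_ae_eq_Icc.symm, Real.volume_Icc]
  refine ENNReal.div_le_of_le_mul (le_trans (lintegral_mono fun y => ?_) (h4 n))
  exact indicator_le_self _ _ _

end StoppingSet

/-- The reverse Hölder inequality with the explicit dependence of the exponent on the rate `η`. -/
theorem lintegral_rpow_one_add_le {w : ℝ → ℝ≥0∞} {η : ℝ≥0∞} (hwm : AEMeasurable w volume)
    (hw : ∀ a b : ℝ, a < b → ∀ E ⊆ Ioc a b, MeasurableSet E →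
      2 * volume E ≤ ENNReal.ofReal (b - a) → ∫⁻ y in E, w y ≤ η * ∫⁻ y in Ioc a b, w y)
    {ε : ℝ} (hε : 0 < ε) (hεη : 4 ^ ε * (1 + η) ≤ 2) {a b : ℝ} (hab : a < b)
    (hfin : ∫⁻ y in Ioc a b, w y ≠ ∞) :
    ∫⁻ y in Ioc a b, w y ^ (1 + ε) ≤
      2 * ((∫⁻ y in Ioc a b, w y) / ENNReal.ofReal (b - a)) ^ ε * ∫⁻ y in Ioc a b, w y := by
  set W := ∫⁻ y in Ioc a b, w y with hW
  set m := W / ENNReal.ofReal (b - a) with hm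
  have hba : ENNReal.ofReal (b - a) ≠ 0 := by simpa using hab
  rcases eq_or_ne W 0 with h0 | h0
  · have : ∀ᵐ y ∂volume.restrict (Ioc a b), w y = 0 := by
      have := (lintegral_eq_zero_iff' hwm.restrict).1 h0
      filter_upwards [this] with y hy using hy
    rw [h0, mul_zero, nonpos_iff_eq_zero, lintegral_eq_zero_iff' (hwm.restrict.pow_const _)]
    filter_upwards [this] with y hy
    simp [hy, ENNReal.zero_rpow_of_pos (by linarith : 0 < 1 + ε)]
  have hm0 : m ≠ 0 := by simp [hm, h0]
  have hmt : m ≠ ∞ := ENNReal.div_ne_top hfin hba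
  have hmW : m * ENNReal.ofReal (b - a) = W := ENNReal.div_mul_cancel hba ENNReal.ofReal_ne_top
  set Ω : ℕ → Set ℝ := fun k => ⋃ n, stoppingSet w (4 ^ k * m) n a b with hΩ
  have hΩm : ∀ k, MeasurableSet (Ω k) := fun k =>
    MeasurableSet.iUnion fun n => measurableSet_stoppingSet n
  have hΩsub : ∀ k, Ω k ⊆ Ioc a b := fun k => iUnion_subset fun n => stoppingSet_subset n hab.le
  have hΩlim : ∀ k, ∫⁻ y in Ω k, w y = ⨆ n, ∫⁻ y in stoppingSet w (4 ^ k * m) n a b, w y :=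
    fun k => setLIntegral_iUnion_of_directed _ (monotone_nat_of_le_succ
      (fun n => stoppingSet_subset_succ n)).directed_le
  have hdecay : ∀ k, ∫⁻ y in Ω k, w y ≤ η ^ k * W := by
    intro k
    induction k with
    | zero => simpa using lintegral_mono_set (hΩsub 0)
    | succ k ih =>
      rw [hΩlim]
      refine iSup_le fun n => ?_
      rw [pow_succ', mul_assoc, pow_succ', mul_assoc]
      refine (lintegral_stoppingSet_four_mul_le hw (by simp [hm0])
        (ENNReal.mul_ne_top (by simp) hmt) n hab ?_).trans ?_
      · rw [← hW, ← hmW]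
        gcongr
        rw [← mul_assoc]
        refine le_mul_of_one_le_left' (one_le_mul (by norm_num) (one_le_pow₀ (by norm_num)))
      · gcongr
        exact (lintegral_mono_set (subset_iUnion _ n)).trans ih
  set θ : ℝ≥0∞ := 4 ^ ε with hθ
  have hθ1 : 1 < θ := ENNReal.one_lt_rpow (by norm_num) hε
  have hθt : θ ≠ ∞ := ENNReal.rpow_ne_top_of_nonneg hε.le (by simp)
  -- Discrete layer-cake: if `k` is the first index with `y ∉ Ω k`, then `w y ≤ 4 ^ k * m`, and `θ ^
  -- k` splits into contributions of the sets `Ω j`, `j < k`, all containing `y`.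
  have hgeom : ∀ k : ℕ, 1 + ∑ j ∈ Finset.range k, (θ - 1) * θ ^ j = θ ^ k := by
    intro k
    induction k with
    | zero => simp
    | succ k ih =>
      rw [Finset.sum_range_succ, ← add_assoc, ih, pow_succ']
      nth_rw 1 [← one_mul (θ ^ k)]
      rw [← add_mul, add_tsub_cancel_of_le hθ1.le]
  have hpt : ∀ᵐ y ∂volume.restrict (Ioc a b), w y ^ (1 + ε) ≤
      m ^ ε * (w y + ∑' k, (θ - 1) * θ ^ k * (Ω k).indicator w y) := by
    rw [ae_restrict_iff' measurableSet_Ioc]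
    filter_upwards [ae_le_of_forall_notMem_stoppingSet hwm hfin] with y hy hyI
    suffices h : w y ^ ε ≤ m ^ ε * (1 + ∑' k, (θ - 1) * θ ^ k * (Ω k).indicator 1 y) by
      rw [ENNReal.rpow_add_of_nonneg _ _ zero_le_one hε.le, ENNReal.rpow_one]
      refine (mul_le_mul_right h (w y)).trans (le_of_eq ?_)
      rw [mul_left_comm, mul_add, mul_one, ← ENNReal.tsum_mul_left]
      congr 3
      ext k
      by_cases hk : y ∈ Ω k <;> simp [hk, mul_comm]
    -- If no such first index exists, the right-hand series diverges and there is nothing to prove.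
    by_cases hall : ∀ k, y ∈ Ω k
    · have : ∑' k, (θ - 1) * θ ^ k * (Ω k).indicator (1 : ℝ → ℝ≥0∞) y = ∞ := by
        refine top_unique ?_
        rw [← ENNReal.tsum_const_eq_top_of_ne_zero (α := ℕ) (tsub_pos_of_lt hθ1).ne']
        refine ENNReal.tsum_le_tsum fun k => ?_
        rw [indicator_of_mem (hall k)]
        rw [Pi.one_apply, mul_one]
        exact le_mul_of_one_le_right' (one_le_pow₀ hθ1.le)
      rw [this, add_top, ENNReal.mul_top]
      · exact le_top
      · exact (ENNReal.rpow_pos (pos_iff_ne_zero.2 hm0) hmt).ne'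
    · push Not at hall
      classical
      have hk := Nat.find_spec hall
      set k := Nat.find hall
      have hle : w y ≤ 4 ^ k * m := hy _ hyI fun n hn => hk (mem_iUnion.2 ⟨n, hn⟩)
      calc w y ^ ε ≤ (4 ^ k * m) ^ ε := ENNReal.rpow_le_rpow hle hε.le
        _ = m ^ ε * θ ^ k := by
          rw [ENNReal.mul_rpow_of_nonneg _ _ hε.le, mul_comm, hθ, ← ENNReal.rpow_natCast,
            ← ENNReal.rpow_natCast, ← ENNReal.rpow_mul, ← ENNReal.rpow_mul, mul_comm ε]
        _ ≤ _ := by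
          rw [← hgeom k]
          gcongr
          refine le_trans (Finset.sum_le_sum fun j hj => ?_) (ENNReal.sum_le_tsum (Finset.range k))
          have : y ∈ Ω j := not_not.1 (Nat.find_min hall (Finset.mem_range.1 hj))
          simp [this]
  -- The condition `θ(1 + η) ≤ 2` rearranges to `θ - 1 ≤ 1 - θη`, which bounds the geometric sum `(θ
  -- - 1)/(1 - θη)` by `1`.
  have hsum : ∑' k, (θ - 1) * θ ^ k * η ^ k ≤ 1 := by
    have hle : θ - 1 ≤ 1 - θ * η := by
      have hη : θ * η ≠ ∞ := by
        intro h
        rw [mul_add, h] at hεη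
        simp at hεη
      refine ENNReal.le_sub_of_add_le_right hη ?_
      refine (ENNReal.add_le_add_iff_right ENNReal.one_ne_top).1 ?_
      calc θ - 1 + θ * η + 1 = (θ - 1 + 1) + θ * η := by ring
        _ = θ * (1 + η) := by rw [tsub_add_cancel_of_le hθ1.le]; ring
        _ ≤ 1 + 1 := by rw [one_add_one_eq_two]; exact hεη
    have h0 : 1 - θ * η ≠ 0 := fun h => by
      rw [h, nonpos_iff_eq_zero] at hle
      exact (tsub_pos_of_lt hθ1).ne' hle
    simp_rw [mul_assoc, ← mul_pow]
    rw [ENNReal.tsum_mul_left, ENNReal.tsum_geometric]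
    calc (θ - 1) * (1 - θ * η)⁻¹ ≤ (1 - θ * η) * (1 - θ * η)⁻¹ := by gcongr
      _ = 1 := ENNReal.mul_inv_cancel h0 (ENNReal.sub_ne_top ENNReal.one_ne_top)
  calc ∫⁻ y in Ioc a b, w y ^ (1 + ε)
      ≤ ∫⁻ y in Ioc a b, m ^ ε * (w y + ∑' k, (θ - 1) * θ ^ k * (Ω k).indicator w y) :=
        lintegral_mono_ae hpt
    _ = m ^ ε * (W + ∑' k, (θ - 1) * θ ^ k * ∫⁻ y in Ω k, w y) := by
        have hmeas : ∀ k, AEMeasurable ((Ω k).indicator w) (volume.restrict (Ioc a b)) :=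
          fun k => hwm.restrict.indicator (hΩm k)
        rw [lintegral_const_mul' _ _ (ENNReal.rpow_ne_top_of_nonneg hε.le hmt),
          lintegral_add_left' hwm.restrict, lintegral_tsum fun k => (hmeas k).const_mul _]
        congr 3
        ext k
        rw [lintegral_const_mul' _ _ (ENNReal.mul_ne_top (ENNReal.sub_ne_top hθt)
          (ENNReal.pow_ne_top hθt)), lintegral_indicator (hΩm k),
          Measure.restrict_restrict (hΩm k), inter_eq_left.2 (hΩsub k)]
    _ ≤ m ^ ε * (W + ∑' k, ((θ - 1) * θ ^ k * η ^ k) * W) := by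
        refine mul_le_mul_right (add_le_add_right (ENNReal.tsum_le_tsum fun k => ?_) _) _
        rw [mul_assoc _ (η ^ k)]
        exact mul_le_mul_right (hdecay k) _
    _ ≤ m ^ ε * (W + 1 * W) := by
        rw [ENNReal.tsum_mul_right]
        gcongr
    _ = 2 * m ^ ε * W := by ring

/-! ### The Hardy–Littlewood maximal function -/

/-- The union of the open interiors is open, and only endpoints outside it can be missing. Intervals
attached to distinct right endpoints outside that open set have disjoint interiors, hence there are
countably many such points; likewise on the left. -/
lemma measurableSet_iUnion_Icc {ι : Type*} (a b : ι → ℝ) (h : ∀ i, a i < b i) :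
    MeasurableSet (⋃ i, Icc (a i) (b i)) := by
  set U := ⋃ i, Ioo (a i) (b i) with hU
  have hUo : IsOpen U := isOpen_iUnion fun i => isOpen_Ioo
  have hR : (range b \ U).Countable := by
    choose i hi using fun x : ↥(range b \ U) => x.2.1
    have key : ∀ x y : ↥(range b \ U), (x : ℝ) < y →
        Disjoint (Ioo (a (i x)) (b (i x))) (Ioo (a (i y)) (b (i y))) := by
      intro x y hxy
      have : (x : ℝ) ≤ a (i y) := by
        by_contra! hc
        exact x.2.2 (mem_iUnion.2 ⟨i y, hc, by rwa [hi y]⟩)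
      refine Set.disjoint_left.2 fun z hz hz' => ?_
      have := hi x
      linarith [hz.2, hz'.1]
    rw [← Set.countable_coe_iff, ← Set.countable_univ_iff]
    refine Set.PairwiseDisjoint.countable_of_nonempty_interior
      (s := fun x => Ioo (a (i x)) (b (i x))) ?_ ?_
    · intro x _ y _ hxy
      rcases lt_or_gt_of_ne (Subtype.coe_ne_coe.2 hxy) with h' | h'
      exacts [key x y h', (key y x h').symm]
    · intro x _
      rw [interior_Ioo]
      exact nonempty_Ioo.2 (h _)
  have hL : (range a \ U).Countable := by
    choose i hi using fun x : ↥(range a \ U) => x.2.1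
    have key : ∀ x y : ↥(range a \ U), (x : ℝ) < y →
        Disjoint (Ioo (a (i x)) (b (i x))) (Ioo (a (i y)) (b (i y))) := by
      intro x y hxy
      have : b (i x) ≤ y := by
        by_contra! hc
        exact y.2.2 (mem_iUnion.2 ⟨i x, by rwa [hi x], hc⟩)
      refine Set.disjoint_left.2 fun z hz hz' => ?_
      have := hi y
      linarith [hz.2, hz'.1]
    rw [← Set.countable_coe_iff, ← Set.countable_univ_iff]
    refine Set.PairwiseDisjoint.countable_of_nonempty_interior
      (s := fun x => Ioo (a (i x)) (b (i x))) ?_ ?_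
    · intro x _ y _ hxy
      rcases lt_or_gt_of_ne (Subtype.coe_ne_coe.2 hxy) with h' | h'
      exacts [key x y h', (key y x h').symm]
    · intro x _
      rw [interior_Ioo]
      exact nonempty_Ioo.2 (h _)
  have heq : (⋃ i, Icc (a i) (b i)) =
      U ∪ ((⋃ i, Icc (a i) (b i)) ∩ ((range b \ U) ∪ (range a \ U))) := by
    ext x
    constructor
    · intro hx
      by_cases hxU : x ∈ U
      · exact Or.inl hxU
      refine Or.inr ⟨hx, ?_⟩
      obtain ⟨i, hi⟩ := mem_iUnion.1 hx
      rcases eq_or_lt_of_le hi.1 with h1 | h1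
      · exact Or.inr ⟨⟨i, h1⟩, hxU⟩
      rcases eq_or_lt_of_le hi.2 with h2 | h2
      · exact Or.inl ⟨⟨i, h2.symm⟩, hxU⟩
      exact absurd (mem_iUnion.2 ⟨i, ⟨h1, h2⟩⟩ : x ∈ U) hxU
    · rintro (hx | hx)
      · exact iUnion_mono (fun i => Ioo_subset_Icc_self) hx
      · exact hx.1
  rw [heq]
  exact hUo.measurableSet.union ((hR.union hL).mono inter_subset_right).measurableSet

/-- The supremum over the closed intervals containing a point of any function of the interval
is measurable. -/
lemma measurable_iSup_Icc (c : ℝ → ℝ → ℝ≥0∞) :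
    Measurable fun x => ⨆ (a : ℝ) (b : ℝ) (_ : a < b) (_ : x ∈ Icc a b), c a b := by
  refine measurable_of_Ioi fun s => ?_
  have : (fun x => ⨆ (a : ℝ) (b : ℝ) (_ : a < b) (_ : x ∈ Icc a b), c a b) ⁻¹' Ioi s =
      ⋃ i : {p : ℝ × ℝ // p.1 < p.2 ∧ s < c p.1 p.2}, Icc i.1.1 i.1.2 := by
    ext x
    simp only [mem_preimage, mem_Ioi, lt_iSup_iff, mem_iUnion, Subtype.exists, Prod.exists]
    constructor
    · rintro ⟨a, b, h1, h2, h3⟩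
      exact ⟨a, b, ⟨h1, h3⟩, h2⟩
    · rintro ⟨a, b, ⟨h1, h3⟩, h2⟩
      exact ⟨a, b, h1, h2, h3⟩
  rw [this]
  exact measurableSet_iUnion_Icc _ _ fun i => i.2.1

/-- The uncentred Hardy–Littlewood maximal function on the line. -/
noncomputable def maximalFunction (g : ℝ → ℝ≥0∞) (x : ℝ) : ℝ≥0∞ :=
  ⨆ (a : ℝ) (b : ℝ) (_ : a < b) (_ : x ∈ Icc a b), ⨍⁻ y in Icc a b, g y ∂volume

lemma measurable_maximalFunction (g : ℝ → ℝ≥0∞) : Measurable (maximalFunction g) :=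
  measurable_iSup_Icc _

lemma lintegral_Icc_average_le_maximalFunction (g : ℝ → ℝ≥0∞) {a b x : ℝ} (hab : a < b)
    (hx : x ∈ Icc a b) : ⨍⁻ y in Icc a b, g y ∂volume ≤ maximalFunction g x :=
  le_iSup₂_of_le a b (le_iSup₂_of_le hab hx le_rfl)

/-- Vitali covering: the level set lies in the fourfold enlargements of disjoint intervals `I` with
`s|I| < ∫_I g`. Any enlargement factor above `3` would do. -/
lemma mul_volume_lt_maximalFunction_le (g : ℝ → ℝ≥0∞) (s : ℝ≥0∞) :
    s * volume {x | s < maximalFunction g x} ≤ 4 * ∫⁻ y, g y := by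
  rcases eq_or_ne s 0 with rfl | hs
  · simp
  rcases eq_or_ne s ∞ with rfl | hs'
  · simp
  rcases eq_or_ne (∫⁻ y, g y) ∞ with hg | hg
  · simp [hg]
  set T : Set (ℝ × ℝ) := {p | p.1 < p.2 ∧ s * ENNReal.ofReal (p.2 - p.1) <
    ∫⁻ y in Icc p.1 p.2, g y} with hT
  have hsub : {x | s < maximalFunction g x} ⊆ ⋃ p ∈ T, Icc p.1 p.2 := by
    intro x hx
    simp only [mem_ofPred_eq, maximalFunction, lt_iSup_iff] at hx
    obtain ⟨a, b, hab, hxI, h⟩ := hx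
    refine mem_biUnion (x := (a, b)) ⟨hab, ?_⟩ hxI
    rw [setLAverage_eq, Real.volume_Icc] at h
    exact ENNReal.mul_lt_of_lt_div h
  have hrad : ∀ p ∈ T, (p.2 - p.1) / 2 ≤ ((∫⁻ y, g y) / s).toReal := by
    intro p hp
    have h1 : ENNReal.ofReal (p.2 - p.1) ≤ (∫⁻ y, g y) / s := by
      rw [ENNReal.le_div_iff_mul_le (Or.inl hs) (Or.inl hs'), mul_comm]
      exact hp.2.le.trans (setLIntegral_le_lintegral _ _)
    have h2 := (ENNReal.ofReal_le_iff_le_toReal (ENNReal.div_ne_top hg hs)).1 h1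
    linarith [hp.1]
  obtain ⟨u, huT, hdisj, hcov⟩ := Vitali.exists_disjoint_subfamily_covering_enlargement_closedBall
    T (fun p => (p.1 + p.2) / 2) (fun p => (p.2 - p.1) / 2) _ hrad 4 (by norm_num)
  have hball : ∀ p : ℝ × ℝ, Metric.closedBall ((p.1 + p.2) / 2) ((p.2 - p.1) / 2) =
      Icc p.1 p.2 := fun p => by rw [Real.closedBall_eq_Icc]; congr 1 <;> ring
  simp only [hball] at hdisj hcov
  have hu : u.Countable := hdisj.countable_of_nonempty_interior fun p hp => by
    rw [interior_Icc]; exact nonempty_Ioo.2 (huT hp).1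
  have hsub' : {x | s < maximalFunction g x} ⊆
      ⋃ p ∈ u, Metric.closedBall ((p.1 + p.2) / 2) (4 * ((p.2 - p.1) / 2)) := by
    refine hsub.trans (iUnion₂_subset fun p hp => ?_)
    obtain ⟨q, hq, hpq⟩ := hcov p hp
    exact hpq.trans (subset_biUnion_of_mem (u := fun q : ℝ × ℝ =>
      Metric.closedBall ((q.1 + q.2) / 2) (4 * ((q.2 - q.1) / 2))) hq)
  calc s * volume {x | s < maximalFunction g x}
      ≤ s * ∑' p : u, volume (Metric.closedBall ((p.1.1 + p.1.2) / 2)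
          (4 * ((p.1.2 - p.1.1) / 2))) := by
        gcongr
        exact (measure_mono hsub').trans (measure_biUnion_le _ hu _)
    _ = ∑' p : u, 4 * (s * ENNReal.ofReal (p.1.2 - p.1.1)) := by
        rw [← ENNReal.tsum_mul_left]
        congr 1
        ext p
        rw [Real.volume_closedBall, mul_left_comm 4, ← ENNReal.ofReal_ofNat 4,
          ← ENNReal.ofReal_mul (by norm_num)]
        congr 2
        simp only [OfNat.ofNat]
        ring
    _ ≤ ∑' p : u, 4 * ∫⁻ y in Icc p.1.1 p.1.2, g y := by
        gcongr with p
        exact (huT p.2).2.le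
    _ = 4 * ∫⁻ y in ⋃ p ∈ u, Icc p.1 p.2, g y := by
        rw [ENNReal.tsum_mul_left, lintegral_biUnion hu (fun p _ => measurableSet_Icc) hdisj]
    _ ≤ 4 * ∫⁻ y, g y := mul_le_mul_right (setLIntegral_le_lintegral _ _) _

/-- The part of `f` below `t/2` raises the maximal function by at most `t/2`, so the weak-type bound
at level `t/2` is needed only for the part above `t/2`; hence `8 = 2 · 4`. -/
lemma mul_volume_lt_maximalFunction_ofReal_le {f : ℝ → ℝ} (hf : AEMeasurable f volume)
    (t : ℝ) :
    ENNReal.ofReal t * volume {x | ENNReal.ofReal t <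
        maximalFunction (fun y => ENNReal.ofReal (f y)) x} ≤
      8 * (volume.withDensity fun y => ENNReal.ofReal (f y)) {y | t < 2 * f y} := by
  set g : ℝ → ℝ≥0∞ := fun y => ENNReal.ofReal (f y) with hg
  set A : Set ℝ := {y | t < 2 * f y} with hA
  have hAm : NullMeasurableSet A volume := nullMeasurableSet_lt aemeasurable_const (hf.const_mul 2)
  have htt : ENNReal.ofReal t = 2 * ENNReal.ofReal (t / 2) := by
    rw [← ENNReal.ofReal_ofNat, ← ENNReal.ofReal_mul (by norm_num)]; congr 1; ring
  have hle : ∀ x, maximalFunction g x ≤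
      ENNReal.ofReal (t / 2) + maximalFunction (A.indicator g) x := by
    intro x
    refine iSup₂_le fun a b => iSup₂_le fun hab hx => ?_
    refine le_trans ?_ (add_le_add_right
      (lintegral_Icc_average_le_maximalFunction (A.indicator g) hab hx) _)
    have hv : volume (Icc a b) ≠ 0 := by simp [hab]
    have hv' : volume (Icc a b) ≠ ∞ := by simp
    rw [setLAverage_eq, setLAverage_eq]
    refine ENNReal.div_le_of_le_mul ?_
    rw [add_mul, ENNReal.div_mul_cancel hv hv', ← setLIntegral_const,
      ← lintegral_add_left measurable_const]
    refine lintegral_mono fun y => ?_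
    by_cases hy : y ∈ A
    · simp [hy]
    · simp only [hy, not_false_eq_true, indicator_of_notMem, add_zero, hg]
      refine ENNReal.ofReal_le_ofReal ?_
      have : ¬ t < 2 * f y := hy
      linarith
  have hsub : {x | ENNReal.ofReal t < maximalFunction g x} ⊆
      {x | ENNReal.ofReal (t / 2) < maximalFunction (A.indicator g) x} := by
    intro x hx
    have h1 : ENNReal.ofReal t < _ := lt_of_lt_of_le hx (hle x)
    rw [htt, two_mul] at h1
    exact (ENNReal.add_lt_add_iff_left ENNReal.ofReal_ne_top).1 h1
  calc ENNReal.ofReal t * volume {x | ENNReal.ofReal t < maximalFunction g x}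
      ≤ 2 * (ENNReal.ofReal (t / 2) *
          volume {x | ENNReal.ofReal (t / 2) < maximalFunction (A.indicator g) x}) := by
        nth_rw 1 [htt]
        rw [mul_assoc]
        exact mul_le_mul_right (mul_le_mul_right (measure_mono hsub) _) _
    _ ≤ 2 * (4 * ∫⁻ y, A.indicator g y) := by
        exact mul_le_mul_right (mul_volume_lt_maximalFunction_le _ _) _
    _ = 8 * (volume.withDensity g) A := by
        rw [lintegral_indicator₀ hAm, withDensity_apply₀ _ hAm, ← mul_assoc]
        norm_num

/-- Marcinkiewicz interpolation by integrating the truncated weak-type bound over levels. The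
constant is `r · 8 · 2^(r-1)/(r-1)` with `r ≤ 2`; its growth rate as `r → 1` determines the final
power of the characteristic. -/
theorem lintegral_maximalFunction_rpow_le {f : ℝ → ℝ} (hf : AEMeasurable f volume)
    (hf0 : ∀ y, 0 ≤ f y) {r : ℝ} (hr : 1 < r) (hr2 : r ≤ 2) :
    ∫⁻ x, maximalFunction (fun y => ENNReal.ofReal (f y)) x ^ r ≤
      ENNReal.ofReal (32 / (r - 1)) * ∫⁻ y, ENNReal.ofReal (f y) ^ r := by
  set g : ℝ → ℝ≥0∞ := fun y => ENNReal.ofReal (f y) with hg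
  set ν := volume.withDensity g with hν
  have hfν : AEMeasurable f ν := hf.mono_ac (withDensity_absolutelyContinuous _ _)
  have hgm : AEMeasurable g volume := hf.ennreal_ofReal
  have hr0 : 0 < r := by linarith
  have hr1 : 0 < r - 1 := by linarith
  -- The layer-cake formula concerns real-valued functions; monotone convergence removes the
  -- truncation at `N`.
  set h : ℕ → ℝ → ℝ := fun N x => (min (maximalFunction g x) N).toReal with hh
  have hfin : ∀ (N : ℕ) x, min (maximalFunction g x) (N : ℝ≥0∞) ≠ ∞ := fun N x =>
    ((min_le_right _ _).trans_lt (ENNReal.natCast_lt_top N)).ne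
  have hhm : ∀ N, Measurable (h N) := fun N =>
    ((measurable_maximalFunction g).min measurable_const).ennreal_toReal
  have hsup : ∀ x, maximalFunction g x ^ r = ⨆ N, ENNReal.ofReal (h N x ^ r) := by
    intro x
    have h1 : ∀ N, ENNReal.ofReal (h N x ^ r) = (min (maximalFunction g x) N) ^ r := fun N => by
      rw [← ENNReal.ofReal_rpow_of_nonneg ENNReal.toReal_nonneg hr0.le,
        ENNReal.ofReal_toReal (hfin N x)]
    simp_rw [h1]
    have h2 : maximalFunction g x = ⨆ N : ℕ, min (maximalFunction g x) N := by
      rw [← inf_iSup_eq, ENNReal.iSup_natCast, inf_top_eq]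
    nth_rw 1 [h2]
    exact (ENNReal.orderIsoRpow r hr0).map_iSup _
  have hmono : Monotone fun N x => ENNReal.ofReal (h N x ^ r) := by
    intro M N hMN x
    refine ENNReal.ofReal_le_ofReal (Real.rpow_le_rpow ENNReal.toReal_nonneg ?_ hr0.le)
    refine ENNReal.toReal_mono (hfin N x) (min_le_min_left _ ?_)
    exact_mod_cast hMN
  simp_rw [hsup]
  rw [lintegral_iSup (fun N => ((hhm N).pow_const r).ennreal_ofReal) hmono]
  refine iSup_le fun N => ?_
  rw [lintegral_rpow_eq_lintegral_meas_lt_mul volume (Eventually.of_forall fun x =>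
    ENNReal.toReal_nonneg) (hhm N).aemeasurable hr0]
  have hlevel : ∀ t ∈ Ioi (0 : ℝ), volume {x | t < h N x} * ENNReal.ofReal (t ^ (r - 1)) ≤
      8 * (ν {y | t < 2 * f y} * ENNReal.ofReal (t ^ (r - 1 - 1))) := by
    intro t ht
    have ht : 0 < t := ht
    have hsub : {x | t < h N x} ⊆ {x | ENNReal.ofReal t < maximalFunction g x} := by
      intro x hx
      have hx : t < (min (maximalFunction g x) (N : ℝ≥0∞)).toReal := hx
      exact ((ENNReal.ofReal_lt_iff_lt_toReal ht.le (hfin N x)).2 hx).trans_le (min_le_left _ _)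
    have ht' : ENNReal.ofReal (t ^ (r - 1)) =
        ENNReal.ofReal t * ENNReal.ofReal (t ^ (r - 1 - 1)) := by
      rw [← ENNReal.ofReal_mul ht.le]
      congr 1
      nth_rw 2 [← Real.rpow_one t]
      rw [← Real.rpow_add ht]
      congr 1; ring
    rw [ht', ← mul_assoc, ← mul_assoc]
    gcongr ?_ * _
    rw [mul_comm]
    refine le_trans ?_ (mul_volume_lt_maximalFunction_ofReal_le hf t)
    gcongr
  -- The layer-cake formula read backwards, for the measure `f dy` and exponent `r - 1`, is the
  -- source of `1/(r - 1)`.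
  have hν1 : ∫⁻ t in Ioi 0, ν {y | t < 2 * f y} * ENNReal.ofReal (t ^ (r - 1 - 1)) =
      (ENNReal.ofReal (r - 1))⁻¹ * ∫⁻ y, ENNReal.ofReal ((2 * f y) ^ (r - 1)) ∂ν := by
    rw [lintegral_rpow_eq_lintegral_meas_lt_mul ν (Eventually.of_forall fun y =>
      mul_nonneg zero_le_two (hf0 y)) (hfν.const_mul 2) hr1, ← mul_assoc, ENNReal.inv_mul_cancel
      (by simpa using hr) ENNReal.ofReal_ne_top, one_mul]
  have hν2 : ∫⁻ y, ENNReal.ofReal ((2 * f y) ^ (r - 1)) ∂ν ≤ 2 * ∫⁻ y, g y ^ r := by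
    rw [hν, lintegral_withDensity_eq_lintegral_mul₀ hgm
      ((hf.const_mul 2).pow_const _).ennreal_ofReal, ← lintegral_const_mul' _ _ (by simp)]
    refine lintegral_mono fun y => ?_
    simp only [Pi.mul_apply, hg]
    rw [ENNReal.ofReal_rpow_of_nonneg (hf0 y) hr0.le, ← ENNReal.ofReal_ofNat,
      ← ENNReal.ofReal_mul (hf0 y), ← ENNReal.ofReal_mul zero_le_two]
    refine ENNReal.ofReal_le_ofReal ?_
    rw [Real.mul_rpow zero_le_two (hf0 y)]
    have h2 : (2 : ℝ) ^ (r - 1) ≤ 2 := by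
      calc (2 : ℝ) ^ (r - 1) ≤ 2 ^ (1 : ℝ) :=
            Real.rpow_le_rpow_of_exponent_le one_le_two (by linarith)
        _ = 2 := Real.rpow_one 2
    have h3 : f y * f y ^ (r - 1) = f y ^ r := by
      nth_rw 1 [← Real.rpow_one (f y)]
      rw [← Real.rpow_add_of_nonneg (hf0 y) zero_le_one hr1.le]
      congr 1; ring
    calc f y * (2 ^ (r - 1) * f y ^ (r - 1)) = 2 ^ (r - 1) * f y ^ r := by rw [← h3]; ring
      _ ≤ 2 * f y ^ r := mul_le_mul_of_nonneg_right h2 (Real.rpow_nonneg (hf0 y) _)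
  calc ENNReal.ofReal r * ∫⁻ t in Ioi 0, volume {x | t < h N x} * ENNReal.ofReal (t ^ (r - 1))
      ≤ ENNReal.ofReal r * ∫⁻ t in Ioi 0, 8 * (ν {y | t < 2 * f y} *
          ENNReal.ofReal (t ^ (r - 1 - 1))) := by
        gcongr 1
        exact setLIntegral_mono' measurableSet_Ioi hlevel
    _ = ENNReal.ofReal r * (8 * ((ENNReal.ofReal (r - 1))⁻¹ *
          ∫⁻ y, ENNReal.ofReal ((2 * f y) ^ (r - 1)) ∂ν)) := by
        rw [lintegral_const_mul' _ _ (by simp), hν1]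
    _ ≤ ENNReal.ofReal 2 * (8 * ((ENNReal.ofReal (r - 1))⁻¹ * (2 * ∫⁻ y, g y ^ r))) := by
        gcongr
    _ = ENNReal.ofReal (32 / (r - 1)) * ∫⁻ y, g y ^ r := by
        rw [ENNReal.ofReal_div_of_pos hr1, ENNReal.div_eq_inv_mul,
          show (32 : ℝ) = 2 * 16 by norm_num, ENNReal.ofReal_mul zero_le_two]
        simp only [ENNReal.ofReal_ofNat]
        rw [show (16 : ℝ≥0∞) = 8 * 2 by norm_num]
        ring

/-! ### Quadratic forms of positive matrices -/

section Matrix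

variable {d : ℕ} {M S : Matrix (Fin d) (Fin d) ℂ}

lemma inner_toEuclideanCLM_eq_sum (M : Matrix (Fin d) (Fin d) ℂ)
    (u v : EuclideanSpace ℂ (Fin d)) :
    ⟪u, toEuclideanCLM (𝕜 := ℂ) M v⟫_ℂ = ∑ i, ∑ j, star (u i) * M i j * v j := by
  simp only [PiLp.inner_apply, Matrix.ofLp_toEuclideanCLM, Matrix.mulVec, dotProduct,
    RCLike.inner_apply, Finset.sum_mul]
  refine Finset.sum_congr rfl fun i _ => Finset.sum_congr rfl fun j _ => ?_
  simp; ring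

lemma Matrix.IsHermitian.inner_toEuclideanCLM (hS : S.IsHermitian)
    (u v : EuclideanSpace ℂ (Fin d)) :
    ⟪u, toEuclideanCLM (𝕜 := ℂ) S v⟫_ℂ = ⟪toEuclideanCLM (𝕜 := ℂ) S u, v⟫_ℂ := by
  have h : star (toEuclideanCLM (𝕜 := ℂ) S) = toEuclideanCLM (𝕜 := ℂ) S := by
    rw [← map_star]; congr 1
  rw [← ContinuousLinearMap.adjoint_inner_left, ← ContinuousLinearMap.star_eq_adjoint, h]

lemma isHermitian_sqrt (M : Matrix (Fin d) (Fin d) ℂ) : (CFC.sqrt M).IsHermitian :=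
  (Matrix.nonneg_iff_posSemidef.1 (CFC.sqrt_nonneg M)).isHermitian

lemma Matrix.IsHermitian.re_inner_mul_self (hS : S.IsHermitian) (v : EuclideanSpace ℂ (Fin d)) :
    ⟪v, toEuclideanCLM (𝕜 := ℂ) (S * S) v⟫_ℂ = (‖toEuclideanCLM (𝕜 := ℂ) S v‖ ^ 2 : ℝ) := by
  rw [map_mul, mul_apply_eq_comp, hS.inner_toEuclideanCLM, inner_self_eq_norm_sq_to_K]
  simp

lemma Matrix.PosSemidef.sqrt_mul_sqrt (hM : M.PosSemidef) : CFC.sqrt M * CFC.sqrt M = M :=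
  CFC.sqrt_mul_sqrt_self M hM.nonneg

lemma Matrix.PosSemidef.inner_self (hM : M.PosSemidef) (v : EuclideanSpace ℂ (Fin d)) :
    ⟪v, toEuclideanCLM (𝕜 := ℂ) M v⟫_ℂ =
      (‖toEuclideanCLM (𝕜 := ℂ) (CFC.sqrt M) v‖ ^ 2 : ℝ) := by
  rw [← (isHermitian_sqrt M).re_inner_mul_self, hM.sqrt_mul_sqrt]

lemma Matrix.PosSemidef.inner_inv_self (hM : M.PosSemidef) (v : EuclideanSpace ℂ (Fin d)) :
    ⟪v, toEuclideanCLM (𝕜 := ℂ) M⁻¹ v⟫_ℂ =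
      (‖toEuclideanCLM (𝕜 := ℂ) (CFC.sqrt M)⁻¹ v‖ ^ 2 : ℝ) := by
  rw [← (isHermitian_sqrt M).inv.re_inner_mul_self, ← Matrix.mul_inv_rev, hM.sqrt_mul_sqrt]

/-- The quadratic form of a matrix, truncated at zero. -/
noncomputable def quadForm (M : Matrix (Fin d) (Fin d) ℂ) (v : EuclideanSpace ℂ (Fin d)) : ℝ≥0∞ :=
  ENNReal.ofReal (RCLike.re ⟪v, toEuclideanCLM (𝕜 := ℂ) M v⟫_ℂ)

lemma quadForm_ne_top (M : Matrix (Fin d) (Fin d) ℂ) (v : EuclideanSpace ℂ (Fin d)) :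
    quadForm M v ≠ ∞ := ENNReal.ofReal_ne_top

lemma Matrix.PosSemidef.quadForm_eq (hM : M.PosSemidef) (v : EuclideanSpace ℂ (Fin d)) :
    quadForm M v = ‖toEuclideanCLM (𝕜 := ℂ) (CFC.sqrt M) v‖ₑ ^ 2 := by
  rw [quadForm, hM.inner_self, RCLike.re_eq_complex_re, Complex.ofReal_re,
    ENNReal.ofReal_pow (norm_nonneg _), ofReal_norm]

lemma Matrix.PosSemidef.quadForm_inv_eq (hM : M.PosSemidef) (v : EuclideanSpace ℂ (Fin d)) :
    quadForm M⁻¹ v = ‖toEuclideanCLM (𝕜 := ℂ) (CFC.sqrt M)⁻¹ v‖ₑ ^ 2 := by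
  rw [quadForm, hM.inner_inv_self, RCLike.re_eq_complex_re, Complex.ofReal_re,
    ENNReal.ofReal_pow (norm_nonneg _), ofReal_norm]

lemma Matrix.PosSemidef.enorm_inner_self (hM : M.PosSemidef) (v : EuclideanSpace ℂ (Fin d)) :
    ‖⟪toEuclideanCLM (𝕜 := ℂ) M v, v⟫_ℂ‖ₑ = quadForm M v := by
  rw [← hM.isHermitian.inner_toEuclideanCLM, hM.quadForm_eq, hM.inner_self]
  rw [← ofReal_norm, Complex.norm_real, norm_pow, norm_norm, ENNReal.ofReal_pow (norm_nonneg _),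
    ofReal_norm]

lemma enorm_inner_le_mul (u v : EuclideanSpace ℂ (Fin d)) : ‖⟪u, v⟫_ℂ‖ₑ ≤ ‖u‖ₑ * ‖v‖ₑ := by
  rw [← ofReal_norm, ← ofReal_norm, ← ofReal_norm, ← ENNReal.ofReal_mul (norm_nonneg _)]
  exact ENNReal.ofReal_le_ofReal (norm_inner_le_norm u v)

/-- Write `v = M^(1/2) M^(-1/2) v`, move `M^(1/2)` onto `u`, and apply Cauchy–Schwarz. -/
lemma Matrix.PosDef.enorm_inner_sq_le (hM : M.PosDef) (u v : EuclideanSpace ℂ (Fin d)) :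
    ‖⟪u, v⟫_ℂ‖ₑ ^ 2 ≤ quadForm M u * quadForm M⁻¹ v := by
  have hdet : IsUnit (CFC.sqrt M).det := by
    have h := hM.isUnit.map Matrix.detMonoidHom
    rw [← hM.posSemidef.sqrt_mul_sqrt] at h
    simp only [map_mul, isUnit_mul_self_iff] at h
    exact h
  have hv : v = toEuclideanCLM (𝕜 := ℂ) (CFC.sqrt M) (toEuclideanCLM (𝕜 := ℂ) (CFC.sqrt M)⁻¹ v) := by
    rw [← mul_apply_eq_comp, ← map_mul, Matrix.mul_nonsing_inv _ hdet, map_one]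
    rfl
  rw [hM.posSemidef.quadForm_eq, hM.posSemidef.quadForm_inv_eq, ← mul_pow]
  nth_rw 1 [hv]
  rw [(isHermitian_sqrt M).inner_toEuclideanCLM]
  gcongr
  exact enorm_inner_le_mul _ _

/-- Reduces the matrix problem to `d` scalar weights: the `i`-th coordinate of the image is
`⟨M^(-1/2) B eᵢ, u⟩`. -/
lemma enorm_toEuclideanCLM_mul_inv_sqrt_le {B : Matrix (Fin d) (Fin d) ℂ} (hB : B.IsHermitian)
    (hM : M.PosSemidef) (u : EuclideanSpace ℂ (Fin d)) :
    ‖toEuclideanCLM (𝕜 := ℂ) (B * (CFC.sqrt M)⁻¹) u‖ₑ ≤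
      ∑ i, quadForm M⁻¹ (toEuclideanCLM (𝕜 := ℂ) B (EuclideanSpace.single i 1)) ^ (1 / 2 : ℝ) *
        ‖u‖ₑ := by
  set x := toEuclideanCLM (𝕜 := ℂ) (B * (CFC.sqrt M)⁻¹) u with hx
  have h1 : ‖x‖ₑ ≤ ∑ i, ‖x i‖ₑ := by
    have h : x = ∑ i, x i • EuclideanSpace.single i (1 : ℂ) := by
      ext j
      simp [Finset.sum_apply, Pi.single_apply]
    calc ‖x‖ₑ = ‖∑ i, x i • EuclideanSpace.single i (1 : ℂ)‖ₑ := by rw [← h]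
      _ ≤ ∑ i, ‖x i • EuclideanSpace.single i (1 : ℂ)‖ₑ := enorm_sum_le _ _
      _ = ∑ i, ‖x i‖ₑ := by
        refine Finset.sum_congr rfl fun i _ => ?_
        rw [enorm_smul, ← ofReal_norm (EuclideanSpace.single i (1 : ℂ))]
        simp
  refine h1.trans (Finset.sum_le_sum fun i _ => ?_)
  have h2 : x i = ⟪toEuclideanCLM (𝕜 := ℂ) (CFC.sqrt M)⁻¹
      (toEuclideanCLM (𝕜 := ℂ) B (EuclideanSpace.single i 1)), u⟫_ℂ := by
    rw [← (isHermitian_sqrt M).inv.inner_toEuclideanCLM, ← hB.inner_toEuclideanCLM,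
      EuclideanSpace.inner_single_left, hx, map_mul]
    simp
  rw [h2, hM.quadForm_inv_eq, ← ENNReal.rpow_natCast, ← ENNReal.rpow_mul]
  simpa using enorm_inner_le_mul _ _

end Matrix

/-! ### Averages of matrix weights -/

section Average

variable {d : ℕ} {V : ℝ → Matrix (Fin d) (Fin d) ℂ}

lemma integrableOn_inner (hV : ∀ i j, LocallyIntegrable (fun x => V x i j) volume)
    (u v : EuclideanSpace ℂ (Fin d)) (a b : ℝ) :
    IntegrableOn (fun y => ⟪u, toEuclideanCLM (𝕜 := ℂ) (V y) v⟫_ℂ) (Icc a b) volume := by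
  simp_rw [inner_toEuclideanCLM_eq_sum]
  refine integrable_finsetSum _ fun i _ => integrable_finsetSum _ fun j _ => ?_
  exact (((hV i j).integrableOn_isCompact isCompact_Icc).const_mul _).mul_const _

lemma inner_matrixAvg (hV : ∀ i j, LocallyIntegrable (fun x => V x i j) volume)
    (u v : EuclideanSpace ℂ (Fin d)) (a b : ℝ) :
    ⟪u, toEuclideanCLM (𝕜 := ℂ) (matrixAvg V a b) v⟫_ℂ =
      ⨍ y in Icc a b, ⟪u, toEuclideanCLM (𝕜 := ℂ) (V y) v⟫_ℂ := by
  have hi : ∀ i j, IntegrableOn (fun x => V x i j) (Icc a b) volume := fun i j =>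
    (hV i j).integrableOn_isCompact isCompact_Icc
  simp_rw [inner_toEuclideanCLM_eq_sum, setAverage_eq]
  rw [integral_finsetSum _ fun i _ => integrable_finsetSum _ fun j _ =>
    ((hi i j).const_mul _).mul_const _, Finset.smul_sum]
  refine Finset.sum_congr rfl fun i _ => ?_
  rw [integral_finsetSum _ fun j _ => ((hi i j).const_mul _).mul_const _, Finset.smul_sum]
  refine Finset.sum_congr rfl fun j _ => ?_
  rw [integral_mul_const, integral_const_mul, matrixAvg, Matrix.of_apply, setAverage_eq]
  simp only [Complex.real_smul]
  ring

lemma posSemidef_matrixAvg (hV : ∀ i j, LocallyIntegrable (fun x => V x i j) volume)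
    (hpos : ∀ᵐ x ∂(volume : Measure ℝ), (V x).PosSemidef) (a b : ℝ) :
    (matrixAvg V a b).PosSemidef := by
  refine Matrix.PosSemidef.of_dotProduct_mulVec_nonneg ?_ fun x => ?_
  · ext i j
    rw [Matrix.conjTranspose_apply, matrixAvg, Matrix.of_apply, Matrix.of_apply, setAverage_eq,
      setAverage_eq, star_smul, star_trivial, ← starRingEnd_apply, ← integral_conj]
    congr 1
    refine integral_congr_ae (ae_restrict_of_ae ?_)
    filter_upwards [hpos] with y hy
    exact hy.isHermitian.apply i j
  · have h : star x ⬝ᵥ matrixAvg V a b *ᵥ x =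
        ⟪WithLp.toLp 2 x, toEuclideanCLM (𝕜 := ℂ) (matrixAvg V a b) (WithLp.toLp 2 x)⟫_ℂ := by
      rw [inner_toEuclideanCLM_eq_sum]
      simp [dotProduct, Matrix.mulVec, Finset.mul_sum, mul_assoc]
    rw [h, inner_matrixAvg hV, setAverage_eq]
    have h2 : ∫ y in Icc a b, ⟪WithLp.toLp 2 x, toEuclideanCLM (𝕜 := ℂ) (V y)
        (WithLp.toLp 2 x)⟫_ℂ = ((∫ y in Icc a b, ‖toEuclideanCLM (𝕜 := ℂ) (CFC.sqrt (V y))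
          (WithLp.toLp 2 x)‖ ^ 2 : ℝ) : ℂ) := by
      rw [← integral_complex_ofReal]
      refine integral_congr_ae (ae_restrict_of_ae ?_)
      filter_upwards [hpos] with y hy
      exact hy.inner_self _
    rw [h2, Complex.real_smul, ← Complex.ofReal_mul, Complex.zero_le_real]
    exact mul_nonneg (inv_nonneg.2 measureReal_nonneg) (integral_nonneg fun y => by positivity)

lemma aemeasurable_quadForm (hV : ∀ i j, LocallyIntegrable (fun x => V x i j) volume)
    (v : EuclideanSpace ℂ (Fin d)) : AEMeasurable (fun y => quadForm (V y) v) volume := by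
  unfold quadForm
  simp_rw [inner_toEuclideanCLM_eq_sum]
  refine AEMeasurable.ennreal_ofReal (RCLike.measurable_re.comp_aemeasurable ?_)
  refine Finset.aemeasurable_fun_sum _ fun i _ => Finset.aemeasurable_fun_sum _ fun j _ => ?_
  exact ((hV i j).aestronglyMeasurable.aemeasurable.const_mul _).mul_const _

lemma lintegral_quadForm (hV : ∀ i j, LocallyIntegrable (fun x => V x i j) volume)
    (hpos : ∀ᵐ x ∂(volume : Measure ℝ), (V x).PosSemidef) (v : EuclideanSpace ℂ (Fin d))
    {a b : ℝ} (hab : a < b) :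
    ∫⁻ y in Ioc a b, quadForm (V y) v =
      ENNReal.ofReal (b - a) * quadForm (matrixAvg V a b) v := by
  have hint := (integrableOn_inner hV v v a b)
  rw [quadForm, inner_matrixAvg hV, setAverage_eq, setLIntegral_congr Ioc_ae_eq_Icc,
    ← ENNReal.ofReal_mul (by linarith)]
  unfold quadForm
  rw [← ofReal_integral_eq_lintegral_ofReal hint.re]
  · rw [integral_re hint]
    congr 1
    simp only [RCLike.re_eq_complex_re, Complex.real_smul, Complex.re_ofReal_mul]
    rw [Real.volume_real_Icc_of_le hab.le, mul_inv_cancel_left₀ (by linarith)]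
  · refine ae_restrict_of_ae ?_
    filter_upwards [hpos] with y hy
    rw [hy.inner_self]
    simp only [RCLike.re_eq_complex_re, Complex.ofReal_re, Pi.zero_apply]
    positivity

end Average

/-! ### The A∞ property of the scalar weights -/

lemma mul_volume_sq_le_of_sq_le_mul {ρ σ : ℝ → ℝ≥0∞} (hρ : AEMeasurable ρ volume)
    (hσ : AEMeasurable σ volume) {c : ℝ≥0∞} (h : ∀ᵐ y ∂(volume : Measure ℝ), c ^ 2 ≤ ρ y * σ y)
    (E : Set ℝ) :
    (c * volume E) ^ 2 ≤ (∫⁻ y in E, ρ y) * ∫⁻ y in E, σ y := by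
  have hsq : ∀ x : ℝ≥0∞, (x ^ (1 / 2 : ℝ)) ^ 2 = x := fun x => by
    rw [← ENNReal.rpow_natCast, ← ENNReal.rpow_mul]; simp
  have hsq' : ∀ x : ℝ≥0∞, (x ^ (1 / 2 : ℝ)) ^ (2 : ℝ) = x := fun x => by
    rw [← ENNReal.rpow_mul]; simp
  have h1 : c * volume E ≤ (∫⁻ y in E, ρ y) ^ (1 / 2 : ℝ) * (∫⁻ y in E, σ y) ^ (1 / 2 : ℝ) := by
    calc c * volume E = ∫⁻ _ in E, c := (setLIntegral_const _ _).symm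
      _ ≤ ∫⁻ y in E, ((fun y => ρ y ^ (1 / 2 : ℝ)) * fun y => σ y ^ (1 / 2 : ℝ)) y := by
        refine lintegral_mono_ae (ae_restrict_of_ae ?_)
        filter_upwards [h] with y hy
        rw [Pi.mul_apply, ← ENNReal.mul_rpow_of_nonneg _ _ (by norm_num)]
        refine le_trans (le_of_eq ?_) (ENNReal.rpow_le_rpow hy (by norm_num : (0:ℝ) ≤ 1 / 2))
        rw [← ENNReal.rpow_natCast, ← ENNReal.rpow_mul]; simp
      _ ≤ _ := by
        refine (ENNReal.lintegral_mul_le_Lp_mul_Lq _ Real.HolderConjugate.two_two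
          (hρ.restrict.pow_const _) (hσ.restrict.pow_const _)).trans (le_of_eq ?_)
        simp_rw [hsq']
  calc (c * volume E) ^ 2
      ≤ ((∫⁻ y in E, ρ y) ^ (1 / 2 : ℝ) * (∫⁻ y in E, σ y) ^ (1 / 2 : ℝ)) ^ 2 := by gcongr
    _ = _ := by rw [mul_pow, hsq, hsq]

section A2

variable {d : ℕ} {V : ℝ → Matrix (Fin d) (Fin d) ℂ}

lemma IsMatrixA2.posSemidef (hV : IsMatrixA2 V) :
    ∀ᵐ x ∂(volume : Measure ℝ), (V x).PosSemidef := by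
  filter_upwards [hV.weight.posDef] with x hx using hx.posSemidef

lemma IsMatrixA2.inv_posSemidef (hV : IsMatrixA2 V) :
    ∀ᵐ x ∂(volume : Measure ℝ), ((V x)⁻¹).PosSemidef := by
  filter_upwards [hV.weight.posDef] with x hx using hx.posSemidef.inv

lemma enorm_sqrt_matrixAvg_mul_sqrt_matrixAvg_inv_sq_le (V : ℝ → Matrix (Fin d) (Fin d) ℂ)
    {a b : ℝ} (hab : a < b) :
    ‖toEuclideanCLM (𝕜 := ℂ) (CFC.sqrt (matrixAvg V a b) *
      CFC.sqrt (matrixAvg (fun x => (V x)⁻¹) a b))‖ₑ ^ 2 ≤ matrixA2Char V :=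
  le_iSup₂_of_le a b (le_iSup_of_le hab le_rfl)

lemma quadForm_matrixAvg_inv_le (hV : IsMatrixA2 V) {a b : ℝ} (hab : a < b)
    {v : EuclideanSpace ℂ (Fin d)} (hv : ‖v‖ₑ ≤ 1) :
    quadForm (matrixAvg (fun x => (V x)⁻¹) a b)
      (toEuclideanCLM (𝕜 := ℂ) (CFC.sqrt (matrixAvg V a b)) v) ≤ matrixA2Char V := by
  have hD := posSemidef_matrixAvg hV.inv_locallyIntegrable hV.inv_posSemidef a b
  rw [hD.quadForm_eq, ← mul_apply_eq_comp, ← map_mul]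
  refine le_trans ?_ (enorm_sqrt_matrixAvg_mul_sqrt_matrixAvg_inv_sq_le V hab)
  gcongr
  -- The factors appear in the reverse of the order in the characteristic; passing to the adjoint
  -- keeps the norm.
  have hstar : ‖toEuclideanCLM (𝕜 := ℂ) (CFC.sqrt (matrixAvg (fun x => (V x)⁻¹) a b) *
      CFC.sqrt (matrixAvg V a b))‖ₑ = ‖toEuclideanCLM (𝕜 := ℂ) (CFC.sqrt (matrixAvg V a b) *
      CFC.sqrt (matrixAvg (fun x => (V x)⁻¹) a b))‖ₑ := by
    rw [← ofReal_norm, ← ofReal_norm, ← norm_star, ← map_star, star_mul]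
    congr 5
    · exact isHermitian_sqrt _
    · exact isHermitian_sqrt _
  rw [← hstar]
  refine (ContinuousLinearMap.le_opENorm _ _).trans ?_
  exact mul_le_of_le_one_right' hv

/-- The test vector `g = ⟨V⁻¹⟩v` makes `⟨g, v⟩` equal to `q = ⟨⟨V⁻¹⟩v, v⟩`, while the A₂ condition
gives `⟨⟨V⟩g, g⟩ ≤ Q q`. Cauchy–Schwarz over `E` then has a common factor `q` to cancel. -/
lemma volume_sq_mul_lintegral_quadForm_inv_le (hV : IsMatrixA2 V)
    (v : EuclideanSpace ℂ (Fin d)) {a b : ℝ} (hab : a < b) {E : Set ℝ} (hE : E ⊆ Ioc a b) :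
    volume E ^ 2 * ∫⁻ y in Ioc a b, quadForm (V y)⁻¹ v ≤
      matrixA2Char V * ENNReal.ofReal (b - a) ^ 2 * ∫⁻ y in E, quadForm (V y)⁻¹ v := by
  have hD := posSemidef_matrixAvg hV.inv_locallyIntegrable hV.inv_posSemidef a b
  have hB := posSemidef_matrixAvg hV.weight.locallyIntegrable hV.posSemidef a b
  set D := matrixAvg (fun x => (V x)⁻¹) a b with hDdef
  set g := toEuclideanCLM (𝕜 := ℂ) D v with hg
  set q := quadForm D v with hq
  have hI : ∫⁻ y in Ioc a b, quadForm (V y)⁻¹ v = ENNReal.ofReal (b - a) * q :=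
    lintegral_quadForm hV.inv_locallyIntegrable hV.inv_posSemidef v hab
  rcases eq_or_ne q 0 with h0 | h0
  · rw [hI, h0]; simp
  have hgq : quadForm (matrixAvg V a b) g ≤ matrixA2Char V * q := by
    rw [hB.quadForm_eq, hq, hD.quadForm_eq, hg]
    nth_rw 1 [← hD.sqrt_mul_sqrt]
    rw [map_mul, mul_apply_eq_comp, ← mul_apply_eq_comp, ← map_mul]
    refine le_trans ?_ (mul_le_mul_left
      (enorm_sqrt_matrixAvg_mul_sqrt_matrixAvg_inv_sq_le V hab) _)
    rw [← mul_pow]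
    gcongr
    exact ContinuousLinearMap.le_opENorm _ _
  have hcs := mul_volume_sq_le_of_sq_le_mul (c := ‖⟪g, v⟫_ℂ‖ₑ)
    (aemeasurable_quadForm hV.weight.locallyIntegrable g)
    (aemeasurable_quadForm hV.inv_locallyIntegrable v)
    (by filter_upwards [hV.weight.posDef] with y hy using hy.enorm_inner_sq_le g v) E
  rw [hD.enorm_inner_self] at hcs
  have hρ : ∫⁻ y in E, quadForm (V y) g ≤ ENNReal.ofReal (b - a) * (matrixA2Char V * q) := by
    refine (lintegral_mono_set hE).trans ?_
    rw [lintegral_quadForm hV.weight.locallyIntegrable hV.posSemidef g hab]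
    gcongr
  rw [hI]
  refine (ENNReal.mul_le_mul_iff_right h0 (quadForm_ne_top D v)).1 ?_
  calc q * (volume E ^ 2 * (ENNReal.ofReal (b - a) * q))
      = ENNReal.ofReal (b - a) * (q * volume E) ^ 2 := by ring
    _ ≤ ENNReal.ofReal (b - a) * ((ENNReal.ofReal (b - a) * (matrixA2Char V * q)) *
          ∫⁻ y in E, quadForm (V y)⁻¹ v) := by
        gcongr
        exact hcs.trans (by gcongr)
    _ = _ := by ring

/-- The preceding estimate with `E` the whole interval, divided by a positive finite integral. -/
lemma one_le_matrixA2Char [NeZero d] (hV : IsMatrixA2 V) : 1 ≤ matrixA2Char V := by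
  set v : EuclideanSpace ℂ (Fin d) := EuclideanSpace.single 0 1 with hv
  have hv0 : v ≠ 0 := by simp [hv]
  have hI := lintegral_quadForm hV.inv_locallyIntegrable hV.inv_posSemidef v zero_lt_one
  have h := volume_sq_mul_lintegral_quadForm_inv_le hV v zero_lt_one subset_rfl
  simp only [Real.volume_Ioc, sub_zero, ENNReal.ofReal_one, one_pow, one_mul, mul_one] at h hI
  have hpos : ∫⁻ y in Ioc (0 : ℝ) 1, quadForm (V y)⁻¹ v ≠ 0 := by
    rw [Ne, lintegral_eq_zero_iff' (aemeasurable_quadForm hV.inv_locallyIntegrable v).restrict]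
    intro h0
    have hne : ∀ᵐ y ∂(volume : Measure ℝ).restrict (Ioc 0 1), False := by
      filter_upwards [h0, ae_restrict_of_ae hV.weight.posDef] with y hy hy'
      have h1 := hy'.enorm_inner_sq_le v v
      rw [show quadForm (V y)⁻¹ v = 0 from hy, mul_zero, nonpos_iff_eq_zero] at h1
      simp [hv0] at h1
    rw [Filter.eventually_false_iff_eq_bot, ae_eq_bot, Measure.restrict_eq_zero] at hne
    simp at hne
  have htop : ∫⁻ y in Ioc (0 : ℝ) 1, quadForm (V y)⁻¹ v ≠ ∞ := by
    rw [hI]; exact quadForm_ne_top _ _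
  rw [← one_mul (∫⁻ y in Ioc (0 : ℝ) 1, quadForm (V y)⁻¹ v), ← mul_assoc, mul_one] at h
  exact (ENNReal.mul_le_mul_iff_left hpos htop).1 h

/-- The complement of `E` fills at least half of the interval, so it carries at least the fraction
`1/(4Q)` of the mass. -/
lemma lintegral_quadForm_inv_le_of_volume_le (hV : IsMatrixA2 V)
    (v : EuclideanSpace ℂ (Fin d)) {a b : ℝ} (hab : a < b) {E : Set ℝ} (hE : E ⊆ Ioc a b)
    (hEm : MeasurableSet E) (hvol : 2 * volume E ≤ ENNReal.ofReal (b - a)) :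
    ∫⁻ y in E, quadForm (V y)⁻¹ v ≤
      (1 - (4 * matrixA2Char V)⁻¹) * ∫⁻ y in Ioc a b, quadForm (V y)⁻¹ v := by
  set Q := matrixA2Char V with hQ
  set L := ENNReal.ofReal (b - a) with hL
  have hL0 : L ≠ 0 := by simpa [hL] using hab
  have hLt : L ≠ ∞ := ENNReal.ofReal_ne_top
  have hsplit := lintegral_inter_add_sdiff (μ := volume) (fun y => quadForm (V y)⁻¹ v) (Ioc a b) hEm
  rw [inter_eq_right.2 hE] at hsplit
  have hcompl : L ≤ 2 * volume (Ioc a b \ E) := by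
    have h1 : volume E + volume (Ioc a b \ E) = L := by
      have := measure_inter_add_sdiff (μ := volume) (Ioc a b) hEm
      rwa [inter_eq_right.2 hE, Real.volume_Ioc] at this
    have hEt : 2 * volume E ≠ ∞ := (hvol.trans_lt hLt.lt_top).ne
    refine (ENNReal.add_le_add_iff_left hEt).1 ?_
    rw [← mul_add, h1]
    exact (add_le_add hvol le_rfl).trans_eq (two_mul L).symm
  have h2 := volume_sq_mul_lintegral_quadForm_inv_le hV v hab (sdiff_subset (s := Ioc a b) (t := E))
  set W := ∫⁻ y in Ioc a b, quadForm (V y)⁻¹ v with hW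
  set X := ∫⁻ y in Ioc a b \ E, quadForm (V y)⁻¹ v with hX
  have hWt : W ≠ ∞ := by
    rw [hW, lintegral_quadForm hV.inv_locallyIntegrable hV.inv_posSemidef v hab]
    exact ENNReal.mul_ne_top hLt (quadForm_ne_top _ _)
  have h3 : W ≤ 4 * Q * X := by
    refine (ENNReal.mul_le_mul_iff_right (pow_ne_zero 2 hL0) (ENNReal.pow_ne_top hLt)).1 ?_
    calc L ^ 2 * W ≤ (2 * volume (Ioc a b \ E)) ^ 2 * W := by gcongr
      _ = 4 * (volume (Ioc a b \ E) ^ 2 * W) := by ring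
      _ ≤ 4 * (Q * L ^ 2 * X) := by gcongr
      _ = L ^ 2 * (4 * Q * X) := by ring
  have h4 : (4 * Q)⁻¹ * W ≤ X := by
    rw [mul_comm, ← div_eq_mul_inv]
    exact ENNReal.div_le_of_le_mul' h3
  have h5 : X ≤ W := by rw [← hsplit]; exact le_add_self
  rw [ENNReal.sub_mul (fun _ _ => hWt), one_mul]
  refine ENNReal.le_sub_of_add_le_right ((h4.trans h5).trans_lt hWt.lt_top).ne ?_
  exact (add_le_add le_rfl h4).trans_eq hsplit

end A2

/-! ### Choice of the exponent, pointwise domination and the norm bound -/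

/-- With `ε = 1/(16q)` and `log 4 ≤ 2`, one has `4^(-ε) ≥ 1 - 2ε = 1 - 1/(8q)`, which is exactly
half of `2 - 1/(4q)`. -/
lemma four_rpow_mul_le_two {q : ℝ} (hq : 1 ≤ q) :
    (4 : ℝ≥0∞) ^ (1 / (16 * q)) * (1 + (1 - (4 * ENNReal.ofReal q)⁻¹)) ≤ 2 := by
  have hq0 : 0 < q := by linarith
  have hlog : Real.log 4 ≤ 2 := by
    rw [show (4 : ℝ) = 2 ^ 2 by norm_num, Real.log_pow]
    have := Real.log_two_lt_d9
    push_cast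
    linarith
  have h1 : 1 - 1 / (8 * q) ≤ (4 : ℝ) ^ (-(1 / (16 * q))) := by
    rw [Real.rpow_def_of_pos (by norm_num)]
    refine le_trans ?_ (Real.add_one_le_exp _)
    have : Real.log 4 * (1 / (16 * q)) ≤ 2 * (1 / (16 * q)) := by gcongr
    have h : 2 * (1 / (16 * q)) = 1 / (8 * q) := by field_simp; norm_num
    linarith
  have h2 : (4 : ℝ) ^ (1 / (16 * q)) * (1 + (1 - (4 * q)⁻¹)) ≤ 2 := by
    have h3 : 1 + (1 - (4 * q)⁻¹) = 2 * (1 - 1 / (8 * q)) := by field_simp; ring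
    have h4 : (4 : ℝ) ^ (1 / (16 * q)) * (4 : ℝ) ^ (-(1 / (16 * q))) = 1 := by
      rw [← Real.rpow_add (by norm_num)]; simp
    calc (4 : ℝ) ^ (1 / (16 * q)) * (1 + (1 - (4 * q)⁻¹))
        = 2 * ((4 : ℝ) ^ (1 / (16 * q)) * (1 - 1 / (8 * q))) := by rw [h3]; ring
      _ ≤ 2 * ((4 : ℝ) ^ (1 / (16 * q)) * (4 : ℝ) ^ (-(1 / (16 * q)))) := by gcongr
      _ = 2 := by rw [h4, mul_one]
  have h5 : (4 * q)⁻¹ ≤ 1 := inv_le_one_of_one_le₀ (by linarith)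
  have h6 : (4 : ℝ≥0∞) = ENNReal.ofReal 4 := by simp
  rw [h6, ← ENNReal.ofReal_mul (by norm_num), ← ENNReal.ofReal_inv_of_pos (by positivity),
    ← ENNReal.ofReal_one, ← ENNReal.ofReal_sub _ (by positivity),
    ← ENNReal.ofReal_add zero_le_one (by linarith), ENNReal.ofReal_rpow_of_pos (by norm_num),
    ← ENNReal.ofReal_mul (by positivity), ← ENNReal.ofReal_ofNat]
  exact ENNReal.ofReal_le_ofReal h2

/-- A bilinear average controlled through a reverse Hölder inequality on the interval. -/
lemma lintegral_rpow_half_mul_le {σ u : ℝ → ℝ≥0∞} (hσ : AEMeasurable σ volume)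
    (hu : AEMeasurable u volume) {ε : ℝ} (hε : 0 < ε) {a b : ℝ} (hab : a < b) {Q : ℝ≥0∞}
    (hrev : ∫⁻ y in Ioc a b, σ y ^ (1 + ε) ≤
      2 * ((∫⁻ y in Ioc a b, σ y) / ENNReal.ofReal (b - a)) ^ ε * ∫⁻ y in Ioc a b, σ y)
    (hQ : ∫⁻ y in Ioc a b, σ y ≤ Q * ENNReal.ofReal (b - a)) {x : ℝ} (hx : x ∈ Icc a b) :
    ∫⁻ y in Icc a b, σ y ^ (1 / 2 : ℝ) * u y ≤
      2 * Q ^ (1 / 2 : ℝ) * maximalFunction (fun y => u y ^ (2 * (1 + ε) / (1 + 2 * ε))) x ^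
        ((1 + 2 * ε) / (2 * (1 + ε))) * ENNReal.ofReal (b - a) := by
  set L := ENNReal.ofReal (b - a) with hL
  have hL0 : L ≠ 0 := by simpa [hL] using hab
  have hLt : L ≠ ∞ := ENNReal.ofReal_ne_top
  set p := 2 * (1 + ε) / (1 + 2 * ε) with hp
  -- Chosen so that `(σ^(1/2))^P = σ^(1+ε)`, which the reverse Hölder hypothesis controls; `p` is
  -- the conjugate exponent.
  set P := 2 * (1 + ε) with hP
  have hP0 : 0 < P := by positivity
  have hPp : P.HolderConjugate p := by
    rw [Real.holderConjugate_iff]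
    refine ⟨by rw [hP]; linarith, ?_⟩
    rw [hP, hp]; field_simp; ring
  have hpinv : (1 + 2 * ε) / P = 1 / p := by rw [hp, one_div_div]
  rw [hpinv]
  have h1 : ∫⁻ y in Icc a b, σ y ^ (1 / 2 : ℝ) * u y ≤
      (∫⁻ y in Icc a b, (σ y ^ (1 / 2 : ℝ)) ^ P) ^ (1 / P) *
        (∫⁻ y in Icc a b, u y ^ p) ^ (1 / p) :=
    ENNReal.lintegral_mul_le_Lp_mul_Lq _ hPp (hσ.restrict.pow_const _) hu.restrict
  have h2 : (∫⁻ y in Icc a b, (σ y ^ (1 / 2 : ℝ)) ^ P) ^ (1 / P) ≤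
      2 * Q ^ (1 / 2 : ℝ) * L ^ (1 / P) := by
    have h3 : ∫⁻ y in Icc a b, (σ y ^ (1 / 2 : ℝ)) ^ P ≤ 2 * Q ^ (1 + ε) * L := by
      rw [← setLIntegral_congr Ioc_ae_eq_Icc]
      simp_rw [← ENNReal.rpow_mul, show 1 / 2 * P = 1 + ε by rw [hP]; ring]
      refine hrev.trans ?_
      calc _ ≤ 2 * Q ^ ε * (Q * L) := by
            gcongr
            exact ENNReal.div_le_of_le_mul hQ
        _ = 2 * Q ^ (1 + ε) * L := by
            rw [ENNReal.rpow_add_of_nonneg _ _ zero_le_one hε.le, ENNReal.rpow_one]; ring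
    refine (ENNReal.rpow_le_rpow h3 (by positivity)).trans ?_
    rw [ENNReal.mul_rpow_of_nonneg _ _ (by positivity),
      ENNReal.mul_rpow_of_nonneg _ _ (by positivity), ← ENNReal.rpow_mul,
      show (1 + ε) * (1 / P) = 1 / 2 by rw [hP]; field_simp]
    gcongr
    calc (2 : ℝ≥0∞) ^ (1 / P) ≤ 2 ^ (1 : ℝ) := by
          refine ENNReal.rpow_le_rpow_of_exponent_le one_le_two ?_
          rw [div_le_one hP0, hP]; linarith
      _ = 2 := ENNReal.rpow_one 2
  have h4 : (∫⁻ y in Icc a b, u y ^ p) ^ (1 / p) ≤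
      maximalFunction (fun y => u y ^ p) x ^ (1 / p) * L ^ (1 / p) := by
    rw [← ENNReal.mul_rpow_of_nonneg _ _ (one_div_nonneg.2 hPp.symm.nonneg)]
    refine ENNReal.rpow_le_rpow ?_ (one_div_nonneg.2 hPp.symm.nonneg)
    have h5 := lintegral_Icc_average_le_maximalFunction (fun y => u y ^ p) hab hx
    rw [setLAverage_eq, Real.volume_Icc] at h5
    exact (ENNReal.div_le_iff hL0 hLt).1 h5
  have h6 : L ^ (1 / P) * L ^ (1 / p) = L := by
    rw [← ENNReal.rpow_add _ _ hL0 hLt, one_div, one_div, hPp.inv_add_inv_eq_one,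
      ENNReal.rpow_one]
  calc _ ≤ (2 * Q ^ (1 / 2 : ℝ) * L ^ (1 / P)) *
        (maximalFunction (fun y => u y ^ p) x ^ (1 / p) * L ^ (1 / p)) :=
        h1.trans (mul_le_mul' h2 h4)
    _ = 2 * Q ^ (1 / 2 : ℝ) * maximalFunction (fun y => u y ^ p) x ^ (1 / p) *
        (L ^ (1 / P) * L ^ (1 / p)) := by ring
    _ = _ := by rw [h6]

section ChristGoldberg

variable {d : ℕ} {V : ℝ → Matrix (Fin d) (Fin d) ℂ}

lemma measurable_christGoldbergMaximal (V : ℝ → Matrix (Fin d) (Fin d) ℂ)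
    (f : ℝ → EuclideanSpace ℂ (Fin d)) : Measurable (christGoldbergMaximal V f) :=
  measurable_iSup_Icc _

/-- The vectors `v i` vary with the interval, which is harmless because the reverse Hölder exponent
and constant are the same for all vectors and intervals. -/
lemma christGoldbergMaximal_le (hV : IsMatrixA2 V) {ε : ℝ} (hε : 0 < ε)
    (hεV : 4 ^ ε * (1 + (1 - (4 * matrixA2Char V)⁻¹)) ≤ 2)
    {f : ℝ → EuclideanSpace ℂ (Fin d)} (hf : AEStronglyMeasurable f volume) (x : ℝ) :
    christGoldbergMaximal V f x ≤ 2 * d * matrixA2Char V ^ (1 / 2 : ℝ) *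
      maximalFunction (fun y => ‖f y‖ₑ ^ (2 * (1 + ε) / (1 + 2 * ε))) x ^
        ((1 + 2 * ε) / (2 * (1 + ε))) := by
  refine iSup₂_le fun a b => iSup₂_le fun hab hx => ?_
  set B := CFC.sqrt (matrixAvg V a b) with hB
  set K := maximalFunction (fun y => ‖f y‖ₑ ^ (2 * (1 + ε) / (1 + 2 * ε))) x ^
        ((1 + 2 * ε) / (2 * (1 + ε))) with hK
  set v : Fin d → EuclideanSpace ℂ (Fin d) := fun i =>
    toEuclideanCLM (𝕜 := ℂ) B (EuclideanSpace.single i 1) with hv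
  have hm := fun i => aemeasurable_quadForm hV.inv_locallyIntegrable (v i)
  have hterm : ∀ i, ∫⁻ y in Icc a b, quadForm (V y)⁻¹ (v i) ^ (1 / 2 : ℝ) * ‖f y‖ₑ ≤
      2 * matrixA2Char V ^ (1 / 2 : ℝ) * K * ENNReal.ofReal (b - a) := by
    intro i
    have hI := lintegral_quadForm hV.inv_locallyIntegrable hV.inv_posSemidef (v i) hab
    refine lintegral_rpow_half_mul_le (hm i) hf.enorm hε hab ?_ ?_ hx
    · refine lintegral_rpow_one_add_le (hm i) (fun a b hab E hE hEm hvol =>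
        lintegral_quadForm_inv_le_of_volume_le hV (v i) hab hE hEm hvol) hε hεV hab ?_
      rw [hI]
      exact ENNReal.mul_ne_top ENNReal.ofReal_ne_top (quadForm_ne_top _ _)
    · rw [hI, mul_comm]
      gcongr
      refine quadForm_matrixAvg_inv_le hV hab (le_of_eq ?_)
      rw [← ofReal_norm]; simp
  rw [setLAverage_eq, Real.volume_Icc]
  refine ENNReal.div_le_of_le_mul ?_
  calc ∫⁻ y in Icc a b, ‖toEuclideanCLM (𝕜 := ℂ) (B * (CFC.sqrt (V y))⁻¹) (f y)‖ₑ
      ≤ ∫⁻ y in Icc a b, ∑ i, quadForm (V y)⁻¹ (v i) ^ (1 / 2 : ℝ) * ‖f y‖ₑ := by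
        refine lintegral_mono_ae (ae_restrict_of_ae ?_)
        filter_upwards [hV.posSemidef] with y hy
        exact enorm_toEuclideanCLM_mul_inv_sqrt_le (isHermitian_sqrt _) hy (f y)
    _ = ∑ i, ∫⁻ y in Icc a b, quadForm (V y)⁻¹ (v i) ^ (1 / 2 : ℝ) * ‖f y‖ₑ :=
        lintegral_finsetSum' _ fun i _ =>
          ((hm i).restrict.pow_const _).mul hf.enorm.restrict
    _ ≤ ∑ _i : Fin d, 2 * matrixA2Char V ^ (1 / 2 : ℝ) * K * ENNReal.ofReal (b - a) :=
        Finset.sum_le_sum fun i _ => hterm i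
    _ = _ := by
        rw [Finset.sum_const, Finset.card_univ, Fintype.card_fin, nsmul_eq_mul]; ring

lemma lintegral_christGoldbergMaximal_sq_le [NeZero d] (hV : IsMatrixA2 V)
    {f : ℝ → EuclideanSpace ℂ (Fin d)} (hf : AEStronglyMeasurable f volume) :
    ∫⁻ x, christGoldbergMaximal V f x ^ (2 : ℝ) ≤
      (64 * d * matrixA2Char V) ^ (2 : ℝ) * ∫⁻ x, ‖f x‖ₑ ^ (2 : ℝ) := by
  set q := (matrixA2Char V).toReal with hq
  have hqQ : ENNReal.ofReal q = matrixA2Char V := ENNReal.ofReal_toReal hV.char_lt_top.ne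
  have hq1 : 1 ≤ q := by
    rw [← ENNReal.ofReal_le_ofReal_iff (by positivity), hqQ, ENNReal.ofReal_one]
    exact one_le_matrixA2Char hV
  have hεV := four_rpow_mul_le_two hq1
  rw [hqQ] at hεV
  set ε := 1 / (16 * q) with hε
  have hε0 : 0 < ε := by positivity
  have hε1 : ε ≤ 1 := by rw [hε, div_le_one (by positivity)]; linarith
  set p := 2 * (1 + ε) / (1 + 2 * ε) with hp
  have hp0 : 0 < p := by positivity
  set r := (1 + 2 * ε) / (1 + ε) with hr
  have hr1 : r - 1 = ε / (1 + ε) := by rw [hr]; field_simp; ring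
  have hr1' : 1 < r := by have : 0 < ε / (1 + ε) := by positivity
                          linarith
  have hr2 : r ≤ 2 := by rw [hr, div_le_iff₀ (by positivity)]; linarith
  have hpr : p * r = 2 := by rw [hp, hr]; field_simp
  have hg : (fun y => ‖f y‖ₑ ^ p) = fun y => ENNReal.ofReal (‖f y‖ ^ p) := by
    ext y
    rw [← ENNReal.ofReal_rpow_of_nonneg (norm_nonneg _) hp0.le, ofReal_norm]
  have hmax := lintegral_maximalFunction_rpow_le (f := fun y => ‖f y‖ ^ p)
    (hf.norm.aemeasurable.pow_const _) (fun y => by positivity) hr1' hr2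
  rw [← hg] at hmax
  have hfr : ∀ y, ENNReal.ofReal (‖f y‖ ^ p) ^ r = ‖f y‖ₑ ^ (2 : ℝ) := fun y => by
    rw [← congrFun hg y, ← ENNReal.rpow_mul, hpr]
  simp_rw [hfr] at hmax
  -- Here `1/(r - 1) = (1 + ε)/ε = 16q(1 + ε)` with `ε ≤ 1`.
  have hconst : ENNReal.ofReal (32 / (r - 1)) ≤ 1024 * matrixA2Char V := by
    rw [← hqQ, ← ENNReal.ofReal_ofNat, ← ENNReal.ofReal_mul (by norm_num)]
    refine ENNReal.ofReal_le_ofReal ?_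
    have h1 : 32 / (r - 1) = 32 * (1 + ε) * (16 * q) := by
      rw [hr1, hε]; field_simp
    rw [h1]
    nlinarith
  have hsq : ∀ x : ℝ≥0∞, x ^ (2 : ℝ) = x ^ 2 := fun x => ENNReal.rpow_two x
  calc ∫⁻ x, christGoldbergMaximal V f x ^ (2 : ℝ)
      ≤ ∫⁻ x, (2 * d * matrixA2Char V ^ (1 / 2 : ℝ)) ^ (2 : ℝ) *
          maximalFunction (fun y => ‖f y‖ₑ ^ p) x ^ r := by
        refine lintegral_mono fun x => ?_
        refine (ENNReal.rpow_le_rpow (christGoldbergMaximal_le hV hε0 hεV hf x)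
          zero_le_two).trans (le_of_eq ?_)
        rw [ENNReal.mul_rpow_of_nonneg _ _ zero_le_two, ← ENNReal.rpow_mul]
        congr 2
        rw [hr]; field_simp
    _ = (2 * d * matrixA2Char V ^ (1 / 2 : ℝ)) ^ (2 : ℝ) *
          ∫⁻ x, maximalFunction (fun y => ‖f y‖ₑ ^ p) x ^ r :=
        lintegral_const_mul _ ((measurable_maximalFunction _).pow_const _)
    _ ≤ (2 * d * matrixA2Char V ^ (1 / 2 : ℝ)) ^ (2 : ℝ) *
          (1024 * matrixA2Char V * ∫⁻ x, ‖f x‖ₑ ^ (2 : ℝ)) :=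
        mul_le_mul_right (hmax.trans (mul_le_mul_left hconst _)) _
    _ = (64 * d * matrixA2Char V) ^ (2 : ℝ) * ∫⁻ x, ‖f x‖ₑ ^ (2 : ℝ) := by
        rw [ENNReal.mul_rpow_of_nonneg _ _ zero_le_two, ← ENNReal.rpow_mul,
          show (1 / 2 * 2 : ℝ) = 1 by norm_num, ENNReal.rpow_one, hsq, hsq]
        ring

end ChristGoldberg

theorem theorem2p1 (d : ℕ) :
    ∃ C : ℝ≥0, ∀ V : ℝ → Matrix (Fin d) (Fin d) ℂ, IsMatrixA2 V →
      ∀ f : ℝ → EuclideanSpace ℂ (Fin d), MemLp f 2 volume →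
        MemLp (christGoldbergMaximal V f) 2 volume ∧
        eLpNorm (christGoldbergMaximal V f) 2 volume
          ≤ C * matrixA2Char V * eLpNorm f 2 volume := by
  -- The constant satisfies `(64d)² = (2d)² · 1024`.
  refine ⟨64 * d, fun V hV f hf => ?_⟩
  have hmain : eLpNorm (christGoldbergMaximal V f) 2 volume
      ≤ (64 * d : ℝ≥0) * matrixA2Char V * eLpNorm f 2 volume := by
    -- Dimension zero is separate because `one_le_matrixA2Char` needs a nonzero vector.
    rcases Nat.eq_zero_or_pos d with rfl | hd
    · have h0 : christGoldbergMaximal V f = 0 := by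
        ext x
        simp only [christGoldbergMaximal, Subsingleton.elim _ (0 : EuclideanSpace ℂ (Fin 0))]
        simp
      rw [h0]; simp
    · have : NeZero d := ⟨hd.ne'⟩
      rw [← ENNReal.rpow_le_rpow_iff (zero_lt_two : (0 : ℝ) < 2),
        ENNReal.mul_rpow_of_nonneg _ _ zero_le_two]
      have h1 := eLpNorm_nnreal_pow_eq_lintegral (μ := volume) (f := christGoldbergMaximal V f)
        (two_ne_zero : (2 : ℝ≥0) ≠ 0)
      have h2 := eLpNorm_nnreal_pow_eq_lintegral (μ := volume) (f := f)
        (two_ne_zero : (2 : ℝ≥0) ≠ 0)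
      simp only [ENNReal.coe_ofNat, NNReal.coe_ofNat, enorm_eq_self] at h1 h2
      rw [h1, h2]
      have h3 := lintegral_christGoldbergMaximal_sq_le hV hf.aestronglyMeasurable
      push_cast
      exact h3
  refine ⟨⟨(measurable_christGoldbergMaximal V f).aestronglyMeasurable, hmain.trans_lt ?_⟩, hmain⟩
  exact ENNReal.mul_lt_top (ENNReal.mul_lt_top ENNReal.coe_lt_top hV.char_lt_top) hf.eLpNorm_lt_top
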